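/- Let $n\ge 1$ and $0<\sigma<1$. For $f\in C_c^\infty(\mathbb R^n)$ (real-valued) let $\hat f(\xi)=(2\pi)^{-n/2}\int_{\mathbb R^n}e^{-i\xi\cdot x}f(x)\,dx$. For a compact set $\Lambda\subset\mathbb R^n$ define the fractional capacity $$\mathrm{Cap}_\sigma(\Lambda)=\inf\left\{\int_{\mathbb R^n}|\xi|^{2\sigma}|\hat f(\xi)|^2\,d\xi:\ f\in C_c^\infty(\mathbb R^n),\ f(x)\ge 1\text{ for all }x\in\Lambda\right\}$$ and, writing $X=(x,t)\in\mathbb R^n\times\mathbb R=\mathbb R^{n+1}$, the weighted extension capacity $$\mu_\sigma(\Lambda)=\inf\left\{\int_{\mathbb R^{n+1}}|t|^{1-2\sigma}|\nabla_X G(X)|^2\,dX:\ G\in C_c^\infty(\mathbb R^{n+1})\text{ real-valued},\ G(x,0)\ge 1\text{ for all }x\in\Lambda\right\}.$$ Then, for every compact set $\Lambda\subset\mathbb R^n$, both capacities are finite and $$\mu_\sigma(\Lambda)=2N(\sigma)\,\mathrm{Cap}_\sigma(\Lambda),\qquad N(\sigma)=\frac{2^{1-2\sigma}\,\Gamma(1-\sigma)}{\Gamma(\sigma)}.$$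 -/

import Mathlib

open scoped ENNReal ContDiff

namespace FracCapacity

/-- The Fourier transform of a real-valued function on `ℝⁿ`, in the unitary normalization with
angular frequency: `f̂(ξ) = (2π)^(-n/2) ∫ e^{-i ξ·x} f(x) dx`. -/
noncomputable def fourierHat {n : ℕ} (f : EuclideanSpace ℝ (Fin n) → ℝ)
    (ξ : EuclideanSpace ℝ (Fin n)) : ℂ :=
  (((2 * Real.pi) ^ (-(n : ℝ) / 2) : ℝ) : ℂ) *
    ∫ x : EuclideanSpace ℝ (Fin n), Complex.exp (-(Complex.I * (inner ℝ ξ x : ℝ))) * (f x : ℂ)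

/-- The energy `∫_{ℝⁿ} |ξ|^{2σ} |f̂(ξ)|² dξ`, with values in `[0, ∞]`. -/
noncomputable def fourierEnergy {n : ℕ} (σ : ℝ) (f : EuclideanSpace ℝ (Fin n) → ℝ) : ℝ≥0∞ :=
  ∫⁻ ξ : EuclideanSpace ℝ (Fin n), ENNReal.ofReal (‖ξ‖ ^ (2 * σ) * ‖fourierHat f ξ‖ ^ 2)

/-- The fractional capacity `Cap_σ(Λ)`: the infimum of the Fourier energy over all
`f ∈ C_c^∞(ℝⁿ)` with `f ≥ 1` on `Λ`. -/
noncomputable def fracCap {n : ℕ} (σ : ℝ) (Λ : Set (EuclideanSpace ℝ (Fin n))) : ℝ≥0∞ :=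
  sInf (fourierEnergy σ '' {f : EuclideanSpace ℝ (Fin n) → ℝ |
    ContDiff ℝ ∞ f ∧ HasCompactSupport f ∧ ∀ x ∈ Λ, 1 ≤ f x})

/-- The squared Euclidean norm `|∇_X G|² = |∇_x G|² + |∂_t G|²` of the full gradient of `G` at
`X = (x, t) ∈ ℝⁿ × ℝ = ℝⁿ⁺¹`. -/
noncomputable def gradSq {n : ℕ} (G : EuclideanSpace ℝ (Fin n) × ℝ → ℝ)
    (X : EuclideanSpace ℝ (Fin n) × ℝ) : ℝ :=
  ‖gradient (fun x => G (x, X.2)) X.1‖ ^ 2 + (deriv (fun t => G (X.1, t)) X.2) ^ 2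

/-- The weighted Dirichlet energy `∫_{ℝⁿ⁺¹} |t|^{1-2σ} |∇_X G|² dX`, with values in `[0, ∞]`. -/
noncomputable def weightedEnergy {n : ℕ} (σ : ℝ) (G : EuclideanSpace ℝ (Fin n) × ℝ → ℝ) : ℝ≥0∞ :=
  ∫⁻ X : EuclideanSpace ℝ (Fin n) × ℝ, ENNReal.ofReal (|X.2| ^ (1 - 2 * σ) * gradSq G X)

/-- The weighted extension capacity `μ_σ(Λ)`: the infimum of the weighted Dirichlet energy over
all `G ∈ C_c^∞(ℝⁿ⁺¹)` with `G(x, 0) ≥ 1` for `x ∈ Λ`. -/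
noncomputable def extCap {n : ℕ} (σ : ℝ) (Λ : Set (EuclideanSpace ℝ (Fin n))) : ℝ≥0∞ :=
  sInf (weightedEnergy σ '' {G : EuclideanSpace ℝ (Fin n) × ℝ → ℝ |
    ContDiff ℝ ∞ G ∧ HasCompactSupport G ∧ ∀ x ∈ Λ, 1 ≤ G (x, 0)})

/-- The constant `N(σ) = 2^{1-2σ} Γ(1-σ) / Γ(σ)`. -/
noncomputable def extConst (σ : ℝ) : ℝ :=
  2 ^ (1 - 2 * σ) * Real.Gamma (1 - σ) / Real.Gamma σ

end FracCapacity

/-! A Fourier transform in `x` alone decouples the problem. By Plancherel on each slice, the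
weighted energy of `G` is the integral over frequencies of `∫ |t|^(1-2σ) (k²|g|² + |g'|²) dt`, where
`k = 2π‖ξ‖` and `g` is the partial transform of `G` at `ξ`. Replacing `t` by `t/k` reduces this to
`k = 1` at the cost of a factor `k^(2σ)`, so everything rests on one sharp constant: the infimum of
`∫ |t|^(1-2σ) (|g|² + |g'|²)` under `g 0 = 1` is `2 N(σ)`.

Lower bound. The minimizer on a half-line is a multiple of `Φ(t) = t^σ K_σ(t)`. The function `W =
-t^(1-2σ) Φ'/Φ` satisfies `W' = W²/t^(1-2σ) - t^(1-2σ)` and `W 0 = N(σ)`. Completing the square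
gives `-(W|g|²)' ≤ t^(1-2σ) (|g|² + |g'|²)`; integration yields `N(σ)|g 0|²` on each half-line.
Summed over frequencies this is `mul_fourierEnergy_le_weightedEnergy`: the trace of any competitor
`G` has Fourier energy at most its weighted energy divided by `2 N(σ)`.

Upper bound. `Φ` is a mixture of Gaussians `e^(-t²/4s)` with weight `e^(-s) s^(σ-1) ds`, but it is
not smooth at `0`. Discarding `s ≤ ε` leaves a smooth profile whose energy, by positivity, does not
exceed that of the full mixture, a double integral that evaluates exactly; its value at `0` is close
to `Γ(σ)` (`exists_profile`). The truncated profile is the characteristic function of a measure with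
all moments, so multiplying the inverse transform of `f` by `φ(2π‖ξ‖t)` gives a smooth extension of
`f` (`contDiff_extension`). It is not compactly supported, but its slices are bounded in `L²`, and a
cutoff at scale `R` then costs only `O(R^(-2σ))` (`exists_compactSupport_weightedEnergy_le`). -/

namespace FracCapacity

open MeasureTheory FourierTransform SchwartzMap Complex

/-! ### Plancherel on `L¹ ∩ L²` and change of Fourier normalization. -/

section Plancherel

variable {E : Type*} [NormedAddCommGroup E] [InnerProductSpace ℝ E] [FiniteDimensional ℝ E]
  [MeasurableSpace E] [BorelSpace E]

/-- The `L²` Fourier transform of an integrable function is given by the Fourier integral. -/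
theorem coeFn_fourier_toLp_ae_eq {u : E → ℂ} (h1 : Integrable u volume) (h2 : MemLp u 2 volume) :
    ((𝓕 (h2.toLp u) : Lp ℂ 2 (volume : Measure E)) : E → ℂ) =ᵐ[volume] 𝓕 u := by
  have hcont : Continuous (𝓕 u) :=
    VectorFourier.fourierIntegral_continuous Real.continuous_fourierChar
      (by exact continuous_inner) h1
  -- Both sides are locally integrable, so testing against smooth compactly supported `g` suffices.
  -- The `L²` transform agrees with the distributional one, and in both pairings the transform can
  -- be moved onto `g`.
  refine ae_eq_of_integral_contDiff_smul_eq
    ((Lp.memLp _).locallyIntegrable (by norm_num)) hcont.locallyIntegrable ?_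
  intro g hg hgc
  let G : 𝓢(E, ℂ) := HasCompactSupport.toSchwartzMap (f := fun x => (g x : ℂ))
    (hgc.comp_left (g := fun r : ℝ => (r : ℂ)) (by simp))
    (Complex.ofRealCLM.contDiff.comp hg)
  have hG : ∀ x, G x = (g x : ℂ) := fun x => rfl
  have key := congrArg (fun T => T G) (Lp.fourier_toTemperedDistribution_eq (h2.toLp u))
  simp only [TemperedDistribution.fourier_apply, Lp.toTemperedDistribution_apply] at key
  have e1 : ∀ x, g x • (𝓕 (h2.toLp u) : Lp ℂ 2 (volume : Measure E)) x
      = G x • (𝓕 (h2.toLp u) : Lp ℂ 2 (volume : Measure E)) x := by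
    intro x; rw [hG]; simp
  have e2 : ∀ x, g x • 𝓕 u x = 𝓕 u x • G x := by
    intro x; rw [hG]; simp [mul_comm]
  simp only [e1, e2]
  rw [← key]
  have := VectorFourier.integral_fourierIntegral_smul_eq_flip (μ := (volume : Measure E))
    (ν := (volume : Measure E)) (L := innerₗ E)
    (f := u) (g := G) Real.continuous_fourierChar (by exact continuous_inner) h1 G.integrable
  refine Eq.trans ?_ this.symm
  refine integral_congr_ae ?_
  filter_upwards [h2.coeFn_toLp] with x hx
  rw [hx, smul_eq_mul, smul_eq_mul, mul_comm, flip_innerₗ]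
  rfl

/-- Plancherel's identity for functions in `L¹ ∩ L²`. -/
theorem lintegral_enorm_fourier_sq {u : E → ℂ} (h1 : Integrable u volume) (h2 : MemLp u 2 volume) :
    ∫⁻ ξ, ‖𝓕 u ξ‖ₑ ^ 2 = ∫⁻ x, ‖u x‖ₑ ^ 2 := by
  have hn : ‖(𝓕 (h2.toLp u) : Lp ℂ 2 (volume : Measure E))‖ₑ = ‖h2.toLp u‖ₑ := by
    rw [← ofReal_norm, ← ofReal_norm, Lp.norm_fourier_eq]
  rw [Lp.enorm_def, Lp.enorm_def, eLpNorm_congr_ae (coeFn_fourier_toLp_ae_eq h1 h2),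
    eLpNorm_congr_ae h2.coeFn_toLp,
    eLpNorm_eq_lintegral_rpow_enorm_toReal (by norm_num) (by norm_num),
    eLpNorm_eq_lintegral_rpow_enorm_toReal (by norm_num) (by norm_num)] at hn
  have := ENNReal.rpow_left_injective (x := 1 / (2 : ℝ≥0∞).toReal) (by norm_num) hn
  simpa using this

end Plancherel


/-- Dilation formula for the Lebesgue integral of nonnegative functions. -/
theorem lintegral_comp_smul {E : Type*} [NormedAddCommGroup E] [NormedSpace ℝ E]
    [FiniteDimensional ℝ E] [MeasurableSpace E] [BorelSpace E] (μ : Measure E) [μ.IsAddHaarMeasure]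
    (f : E → ℝ≥0∞) {r : ℝ} (hr : r ≠ 0) :
    ∫⁻ x, f (r • x) ∂μ = ENNReal.ofReal |(r ^ Module.finrank ℝ E)⁻¹| * ∫⁻ x, f x ∂μ := by
  calc ∫⁻ x, f (r • x) ∂μ
      = ∫⁻ x, f x ∂(Measure.map (Homeomorph.smulOfNeZero r hr).toMeasurableEquiv μ) := by
        rw [lintegral_map_equiv]; rfl
    _ = _ := by
        have : Measure.map (Homeomorph.smulOfNeZero r hr).toMeasurableEquiv μ
          = Measure.map (r • ·) μ := rfl
        rw [this, Measure.map_addHaar_smul _ hr, lintegral_smul_measure, smul_eq_mul]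

theorem fourierHat_eq {n : ℕ} (f : EuclideanSpace ℝ (Fin n) → ℝ) (ξ : EuclideanSpace ℝ (Fin n)) :
    fourierHat f ξ = (((2 * Real.pi) ^ (-(n : ℝ) / 2) : ℝ) : ℂ) *
      𝓕 (fun x => (f x : ℂ)) ((2 * Real.pi)⁻¹ • ξ) := by
  rw [fourierHat, Real.fourier_eq']
  congr 1
  refine integral_congr_ae (Filter.Eventually.of_forall fun x => ?_)
  simp only [smul_eq_mul, real_inner_smul_right]
  congr 2
  rw [real_inner_comm]
  have : (Real.pi : ℂ) ≠ 0 := by exact_mod_cast Real.pi_ne_zero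
  push_cast
  field_simp

/-- The Fourier energy in the normalization of Mathlib's Fourier transform. -/
theorem fourierEnergy_eq {n : ℕ} (σ : ℝ) (f : EuclideanSpace ℝ (Fin n) → ℝ) :
    fourierEnergy σ f = ∫⁻ η : EuclideanSpace ℝ (Fin n),
      ENNReal.ofReal ((2 * Real.pi * ‖η‖) ^ (2 * σ)) * ‖𝓕 (fun x => (f x : ℂ)) η‖ₑ ^ 2 := by
  have hpi : 0 < 2 * Real.pi := by positivity
  have hc : ENNReal.ofReal ((2 * Real.pi) ^ n) ≠ 0 := by
    rw [ENNReal.ofReal_ne_zero_iff]; positivity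
  have h := lintegral_comp_smul (volume : Measure (EuclideanSpace ℝ (Fin n)))
    (fun ξ => ENNReal.ofReal (‖ξ‖ ^ (2 * σ) * ‖fourierHat f ξ‖ ^ 2)) hpi.ne'
  rw [finrank_euclideanSpace_fin, abs_of_pos (by positivity), ENNReal.ofReal_inv_of_pos
    (by positivity)] at h
  rw [fourierEnergy, ← one_mul (lintegral _ _), ← ENNReal.mul_inv_cancel hc ENNReal.ofReal_ne_top,
    mul_assoc, ← h, ← lintegral_const_mul' _ _ ENNReal.ofReal_ne_top]
  refine lintegral_congr fun η => ?_
  rw [fourierHat_eq, smul_smul, inv_mul_cancel₀ hpi.ne', one_smul, norm_mul, norm_smul,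
    ← ENNReal.ofReal_mul (by positivity), ← ofReal_norm, ← ENNReal.ofReal_pow (norm_nonneg _),
    ← ENNReal.ofReal_mul (by positivity)]
  congr 1
  -- The Jacobian of `ξ = 2πη` cancels the squared unitary prefactor exactly.
  have hsq : ((2 * Real.pi) ^ (-(n : ℝ) / 2)) ^ 2 * (2 * Real.pi) ^ n = 1 := by
    rw [← Real.rpow_natCast _ 2, ← Real.rpow_mul hpi.le, ← Real.rpow_natCast _ n,
      ← Real.rpow_add hpi]
    simp
  rw [norm_real, Real.norm_of_nonneg (Real.rpow_nonneg hpi.le _), Real.norm_of_nonneg hpi.le]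
  linear_combination (2 * Real.pi * ‖η‖) ^ (2 * σ) * ‖𝓕 (fun x => (f x : ℂ)) η‖ ^ 2 * hsq

end FracCapacity

/-! ### Bessel-type integrals and the Riccati equation. -/

namespace FracCapacity

open MeasureTheory Set

/-- The integral `∫₀^∞ e^{-r - t²/(4r)} r^{ν-1} dr`, a multiple of `t^ν K_ν(t)`. -/
noncomputable def besselInt (ν t : ℝ) : ℝ :=
  ∫ r in Ioi (0 : ℝ), Real.exp (-r - t ^ 2 / (4 * r)) * r ^ (ν - 1)

/-- The factor `e^(-c/r)` beats any power at `0`: it is at most `k! r^k / c^k`, and `k > -ν` leaves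
a convergent Gamma integrand. Nonpositive `ν` must be allowed because differentiation in `t` lowers
the order by one. -/
theorem integrableOn_exp_sub_div_mul_rpow (ν : ℝ) {c : ℝ} (hc : 0 < c) :
    IntegrableOn (fun r => Real.exp (-r - c / r) * r ^ (ν - 1)) (Ioi (0 : ℝ)) := by
  obtain ⟨k, hk⟩ := exists_nat_gt (-ν)
  have hint := (Real.GammaIntegral_convergent (s := ν + k) (by linarith)).const_mul
    ((k.factorial : ℝ) / c ^ k)
  refine Integrable.mono' hint ?_ ?_
  · refine (ContinuousOn.aestronglyMeasurable ?_ measurableSet_Ioi)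
    intro r hr
    have hr' : r ≠ 0 := (mem_Ioi.1 hr).ne'
    refine ContinuousAt.continuousWithinAt ?_
    refine ContinuousAt.mul ?_ (Real.continuousAt_rpow_const _ _ (Or.inl hr'))
    fun_prop (disch := assumption)
  · filter_upwards [ae_restrict_mem measurableSet_Ioi] with r hr
    have hr : 0 < r := hr
    rw [Real.norm_of_nonneg (by positivity), sub_eq_add_neg, Real.exp_add]
    have h1 := Real.pow_div_factorial_le_exp (x := c / r) (by positivity) k
    have h2 : Real.exp (-(c / r)) ≤ k.factorial / c ^ k * r ^ k := by
      rw [Real.exp_neg]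
      refine inv_le_of_inv_le₀ (by positivity) (le_trans (le_of_eq ?_) h1)
      rw [div_pow]; field_simp
    have h3 : r ^ (ν + k - 1) = r ^ k * r ^ (ν - 1) := by
      rw [← Real.rpow_natCast, ← Real.rpow_add hr]; congr 1; ring
    rw [h3]
    calc Real.exp (-r) * Real.exp (-(c / r)) * r ^ (ν - 1)
        ≤ Real.exp (-r) * (k.factorial / c ^ k * r ^ k) * r ^ (ν - 1) := by gcongr
      _ = _ := by ring

theorem aestronglyMeasurable_besselInt_integrand (ν t : ℝ) :
    AEStronglyMeasurable (fun r => Real.exp (-r - t ^ 2 / (4 * r)) * r ^ (ν - 1))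
      (volume.restrict (Ioi (0 : ℝ))) := by
  refine (Measurable.aestronglyMeasurable ?_)
  fun_prop

theorem integrableOn_besselInt_integrand (ν : ℝ) {t : ℝ} (ht : 0 < t) :
    IntegrableOn (fun r => Real.exp (-r - t ^ 2 / (4 * r)) * r ^ (ν - 1)) (Ioi (0 : ℝ)) := by
  have h := integrableOn_exp_sub_div_mul_rpow ν (c := t ^ 2 / 4) (by positivity)
  simpa only [div_div] using h

theorem besselInt_pos (ν : ℝ) {t : ℝ} (ht : 0 < t) : 0 < besselInt ν t := by
  rw [besselInt, setIntegral_pos_iff_support_of_nonneg_ae _ (integrableOn_besselInt_integrand ν ht)]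
  · have : Function.support (fun r => Real.exp (-r - t ^ 2 / (4 * r)) * r ^ (ν - 1)) ∩ Ioi (0 : ℝ)
        = Ioi 0 := by
      refine inter_eq_right.2 fun r hr => ?_
      have hr : 0 < r := hr
      exact (by positivity : Real.exp (-r - t ^ 2 / (4 * r)) * r ^ (ν - 1) ≠ 0)
    rw [this]; simp
  · filter_upwards [ae_restrict_mem measurableSet_Ioi] with r hr
    have hr : 0 < r := hr
    simp only [Pi.zero_apply]
    positivity

theorem besselInt_zero {ν : ℝ} (hν : 0 < ν) : besselInt ν 0 = Real.Gamma ν := by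
  simp [besselInt, Real.Gamma_eq_integral hν]

theorem continuous_besselInt {ν : ℝ} (hν : 0 < ν) : Continuous (besselInt ν) := by
  refine continuous_of_dominated (fun t => aestronglyMeasurable_besselInt_integrand ν t)
    (fun t => ?_) (Real.GammaIntegral_convergent hν) (ae_of_all _ fun r => by fun_prop)
  filter_upwards [ae_restrict_mem measurableSet_Ioi] with r hr
  have hr : 0 < r := hr
  rw [Real.norm_of_nonneg (by positivity)]
  gcongr
  have : 0 ≤ t ^ 2 / (4 * r) := by positivity
  linarith

theorem hasDerivAt_besselInt (ν : ℝ) {t : ℝ} (ht : 0 < t) :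
    HasDerivAt (besselInt ν) (-(t / 2) * besselInt (ν - 1) t) t := by
  -- Domination on `(t/2, 2t)`: there `x/2 ≤ t`, and the exponential is largest at the left
  -- endpoint.
  have hb : IntegrableOn (fun r => t * (Real.exp (-r - (t / 2) ^ 2 / (4 * r)) * r ^ (ν - 1 - 1)))
      (Ioi (0 : ℝ)) :=
    (integrableOn_besselInt_integrand (ν - 1) (by positivity : 0 < t / 2)).const_mul t
  have h := hasDerivAt_integral_of_dominated_loc_of_deriv_le (μ := volume.restrict (Ioi (0 : ℝ)))
    (F := fun t r => Real.exp (-r - t ^ 2 / (4 * r)) * r ^ (ν - 1))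
    (F' := fun t r => -(t / 2) * (Real.exp (-r - t ^ 2 / (4 * r)) * r ^ (ν - 1 - 1)))
    (x₀ := t) (s := Ioo (t / 2) (2 * t)) (Ioo_mem_nhds (by linarith) (by linarith))
    (Filter.Eventually.of_forall fun t => aestronglyMeasurable_besselInt_integrand ν t)
    (integrableOn_besselInt_integrand ν ht)
    ((aestronglyMeasurable_besselInt_integrand (ν - 1) t).const_mul _) ?_ hb ?_
  · rw [integral_const_mul] at h
    exact h.2
  · filter_upwards [ae_restrict_mem measurableSet_Ioi] with r hr x hx
    have hr : 0 < r := hr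
    have hx0 : 0 < x := by linarith [hx.1]
    rw [norm_mul, norm_neg, Real.norm_of_nonneg (by positivity : 0 ≤ x / 2),
      Real.norm_of_nonneg (by positivity)]
    gcongr
    · linarith [hx.2]
    · exact hx.1.le
  · filter_upwards [ae_restrict_mem measurableSet_Ioi] with r hr x hx
    have hr : 0 < r := hr
    have h1 : HasDerivAt (fun x : ℝ => -r - x ^ 2 / (4 * r)) (-(2 * x / (4 * r))) x := by
      have := ((hasDerivAt_pow 2 x).div_const (4 * r)).const_sub (-r)
      simpa using this
    refine (h1.exp.mul_const (r ^ (ν - 1))).congr_deriv ?_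
    rw [Real.rpow_sub_one hr.ne' (ν - 1)]
    field_simp
    ring

/-- The substitution `r ↦ t²/(4r)`, done as an inversion followed by a dilation; this is the
symmetry `K_{-ν} = K_ν`. It closes the system for orders `σ` and `1 - σ`, whose derivatives have
orders `σ - 1` and `-σ`. -/
theorem besselInt_neg (ν : ℝ) {t : ℝ} (ht : 0 < t) :
    besselInt (-ν) t = (t ^ 2 / 4) ^ (-ν) * besselInt ν t := by
  set q := t ^ 2 / 4 with hq
  have hq0 : 0 < q := by positivity
  have e : ∀ r, t ^ 2 / (4 * r) = q / r := fun r => by rw [hq, div_div]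
  simp only [besselInt, e]
  rw [← integral_comp_rpow_Ioi (fun r => Real.exp (-r - q / r) * r ^ (-ν - 1))
    (p := -1) (by norm_num)]
  have h := integral_comp_mul_left_Ioi' (fun x : ℝ => (|(-1 : ℝ)| * x ^ (-1 - 1 : ℝ)) •
    (Real.exp (-(x ^ (-1 : ℝ)) - q / x ^ (-1 : ℝ)) * (x ^ (-1 : ℝ)) ^ (-ν - 1))) 0
    (b := q⁻¹) (by positivity)
  rw [mul_zero] at h
  rw [← h, ← integral_const_mul, smul_eq_mul, ← integral_const_mul]
  refine setIntegral_congr_fun measurableSet_Ioi fun x hx => ?_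
  have hx : 0 < x := hx
  have e1 : (q⁻¹ * x) ^ (-1 : ℝ) = q / x := by
    rw [Real.rpow_neg_one, mul_inv, inv_inv, div_eq_mul_inv]
  have e2 : (q⁻¹ * x) ^ (-1 - 1 : ℝ) = (q / x) ^ (2 : ℝ) := by
    rw [← e1, ← Real.rpow_mul (by positivity)]; norm_num
  have e3 : q / (q / x) = x := by field_simp
  have e4 : (q / x) ^ (2 : ℝ) * (q / x) ^ (-ν - 1) = q ^ (1 - ν) * x ^ (ν - 1) := by
    rw [← Real.rpow_add (by positivity), Real.div_rpow hq0.le hx.le, div_eq_mul_inv,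
      ← Real.rpow_neg hx.le]
    congr 2 <;> ring
  have e5 : q ^ (1 - ν) = q * q ^ (-ν) := by
    rw [sub_eq_add_neg, Real.rpow_add hq0, Real.rpow_one]
  simp only [e1, e2, e3, smul_eq_mul, abs_neg, abs_one, one_mul]
  have : -(q / x) - x = -x - q / x := by ring
  rw [this]
  calc q⁻¹ * ((q / x) ^ (2 : ℝ) * (Real.exp (-x - q / x) * (q / x) ^ (-ν - 1)))
      = q⁻¹ * Real.exp (-x - q / x) * ((q / x) ^ (2 : ℝ) * (q / x) ^ (-ν - 1)) := by ring
    _ = _ := by rw [e4, e5]; field_simp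

/-- The function `-t^{1-2σ} Φ'(t) / Φ(t)`, where `Φ = besselInt σ` is the radial profile of the
extension of a plane wave. -/
noncomputable def riccatiWeight (σ t : ℝ) : ℝ :=
  2 ^ (1 - 2 * σ) * besselInt (1 - σ) t / besselInt σ t

theorem riccatiWeight_zero {σ : ℝ} (hσ0 : 0 < σ) (hσ1 : σ < 1) :
    riccatiWeight σ 0 = extConst σ := by
  rw [riccatiWeight, besselInt_zero hσ0, besselInt_zero (by linarith), extConst]

/-- After reflection of the order, the powers of `t` in `-t^(1-2σ) Φ'/Φ` cancel, so the quotient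
defining `riccatiWeight` has no singular factor at the origin. -/
theorem continuousOn_riccatiWeight {σ : ℝ} (hσ0 : 0 < σ) (hσ1 : σ < 1) :
    ContinuousOn (riccatiWeight σ) (Ici 0) := by
  refine ContinuousOn.div ((continuous_besselInt (by linarith)).const_mul _).continuousOn
    (continuous_besselInt hσ0).continuousOn fun t ht => ?_
  rcases eq_or_lt_of_le (mem_Ici.1 ht) with rfl | h
  · rw [besselInt_zero hσ0]; exact (Real.Gamma_pos_of_pos hσ0).ne'
  · exact (besselInt_pos σ h).ne'

/-- The Riccati equation for `riccatiWeight`. -/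
theorem hasDerivAt_riccatiWeight (σ : ℝ) {t : ℝ} (ht : 0 < t) :
    HasDerivAt (riccatiWeight σ)
      ((t ^ (1 - 2 * σ))⁻¹ * riccatiWeight σ t ^ 2 - t ^ (1 - 2 * σ)) t := by
  have hA := besselInt_pos σ ht
  have h := ((hasDerivAt_besselInt (1 - σ) ht).const_mul (2 ^ (1 - 2 * σ))).div
    (hasDerivAt_besselInt σ ht) hA.ne'
  refine h.congr_deriv ?_
  -- Reflecting both lowered orders leaves only `A = besselInt σ t` and `B = besselInt (1 - σ) t`;
  -- the rest is the quotient rule and bookkeeping of powers.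
  have e1 : besselInt (1 - σ - 1) t = (t ^ 2 / 4) ^ (-σ) * besselInt σ t := by
    rw [← besselInt_neg σ ht]; congr 1; ring
  have e2 : besselInt (σ - 1) t = (t ^ 2 / 4) ^ (-(1 - σ)) * besselInt (1 - σ) t := by
    rw [← besselInt_neg (1 - σ) ht]; congr 1; ring
  rw [e1, e2, riccatiWeight]
  have ht2 : t ^ 2 / 4 = (t / 2) ^ (2 : ℝ) := by
    rw [Real.rpow_two]; ring
  have p1 : t / 2 * (t ^ 2 / 4) ^ (-σ) = t ^ (1 - 2 * σ) / 2 ^ (1 - 2 * σ) := by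
    rw [← Real.div_rpow ht.le (by norm_num), ht2, ← Real.rpow_mul (by positivity)]
    nth_rewrite 1 [← Real.rpow_one (t / 2)]
    rw [← Real.rpow_add (by positivity)]
    congr 1; ring
  have p2 : t / 2 * (t ^ 2 / 4) ^ (-(1 - σ)) = 2 ^ (1 - 2 * σ) / t ^ (1 - 2 * σ) := by
    rw [← Real.div_rpow (by norm_num) ht.le, ht2, ← Real.rpow_mul (by positivity)]
    nth_rewrite 1 [← Real.rpow_one (t / 2)]
    rw [← Real.rpow_add (by positivity), ← inv_div t 2, Real.inv_rpow (by positivity),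
      ← Real.rpow_neg (by positivity)]
    congr 1; ring
  generalize besselInt σ t = A at *
  generalize besselInt (1 - σ) t = B at *
  have hP : (0 : ℝ) < t ^ (1 - 2 * σ) := by positivity
  have hQ : (0 : ℝ) < 2 ^ (1 - 2 * σ) := by positivity
  generalize t ^ (1 - 2 * σ) = P at *
  generalize (2 : ℝ) ^ (1 - 2 * σ) = Q at *
  have : (Q * (-(t / 2) * ((t ^ 2 / 4) ^ (-σ) * A)) * A
      - Q * B * (-(t / 2) * ((t ^ 2 / 4) ^ (-(1 - σ)) * B)))
      = Q * (B ^ 2 * (t / 2 * (t ^ 2 / 4) ^ (-(1 - σ))) - A ^ 2 * (t / 2 * (t ^ 2 / 4) ^ (-σ))) := by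
    ring
  rw [this, p1, p2]
  field_simp


/-! ### The sharp one-dimensional weighted inequality. -/

theorem intervalIntegrable_abs_rpow_mul {a : ℝ} (ha : -1 < a) {h : ℝ → ℝ} (hh : Continuous h)
    (x y : ℝ) : IntervalIntegrable (fun t => |t| ^ a * h t) volume x y := by
  refine IntervalIntegrable.mul_continuousOn ?_ hh.continuousOn
  have h1 : ∀ b : ℝ, 0 ≤ b → IntervalIntegrable (fun t : ℝ => |t| ^ a) volume 0 b := by
    intro b hb
    refine (intervalIntegral.intervalIntegrable_rpow' ha).congr ?_
    intro t ht
    rw [uIoc_of_le hb] at ht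
    simp only [abs_of_pos ht.1]
  have h2 : ∀ b : ℝ, IntervalIntegrable (fun t : ℝ => |t| ^ a) volume 0 b := by
    intro b
    rcases le_total 0 b with hb | hb
    · exact h1 b hb
    · have := (h1 (-b) (by linarith)).comp_sub_left 0
      simpa using this
  exact (h2 x).symm.trans (h2 y)

theorem extConst_nonneg {σ : ℝ} (hσ0 : 0 < σ) (hσ1 : σ < 1) : 0 ≤ extConst σ := by
  have h1 := Real.Gamma_pos_of_pos hσ0
  have h2 := Real.Gamma_pos_of_pos (sub_pos.2 hσ1)
  rw [extConst]
  positivity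

/-- With `P = t^(1-2σ)` and `W` the Riccati weight, `P(|g|² + |g'|²) + (W|g|²)' = P⁻¹ |W g + P g'|²
≥ 0`. Integrating from `0`, where `W = N(σ)`, to `T`, where `g = 0`, gives the bound. -/
theorem extConst_mul_le_integral {σ : ℝ} (hσ0 : 0 < σ) (hσ1 : σ < 1) {g g' : ℝ → ℂ}
    (hg : ∀ t, HasDerivAt g (g' t) t) (hg' : Continuous g') {T : ℝ} (hT : 0 ≤ T) (hgT : g T = 0) :
    extConst σ * ‖g 0‖ ^ 2 ≤
      ∫ t in (0 : ℝ)..T, |t| ^ (1 - 2 * σ) * (‖g t‖ ^ 2 + ‖g' t‖ ^ 2) := by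
  have hgc : Continuous g := continuous_iff_continuousAt.2 fun t => (hg t).continuousAt
  -- This form of the fundamental theorem needs continuity on `[0, T]` but derivatives only inside,
  -- so no differentiability of `W` at `0` is required.
  have key := intervalIntegral.sub_le_integral_of_hasDeriv_right_of_le
    (g := fun t => -(riccatiWeight σ t * ‖g t‖ ^ 2))
    (g' := fun t => -(((t ^ (1 - 2 * σ))⁻¹ * riccatiWeight σ t ^ 2 - t ^ (1 - 2 * σ)) * ‖g t‖ ^ 2
      + riccatiWeight σ t * (2 * inner ℝ (g t) (g' t))))
    (φ := fun t => |t| ^ (1 - 2 * σ) * (‖g t‖ ^ 2 + ‖g' t‖ ^ 2)) hT ?_ ?_ ?_ ?_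
  · simpa [hgT, riccatiWeight_zero hσ0 hσ1] using key
  · refine (ContinuousOn.mul ((continuousOn_riccatiWeight hσ0 hσ1).mono Icc_subset_Ici_self) ?_).neg
    fun_prop
  · intro t ht
    exact (((hasDerivAt_riccatiWeight σ ht.1).mul (hg t).norm_sq).neg).hasDerivWithinAt
  · rw [← intervalIntegrable_iff_integrableOn_Icc_of_le hT]
    exact intervalIntegrable_abs_rpow_mul (by linarith) (by fun_prop) _ _
  · intro t ht
    have hP : 0 < t ^ (1 - 2 * σ) := Real.rpow_pos_of_pos ht.1 _
    rw [abs_of_pos ht.1]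
    generalize t ^ (1 - 2 * σ) = P at *
    have hi := abs_le.1 (abs_real_inner_le_norm (g t) (g' t))
    generalize inner ℝ (g t) (g' t) = I at *
    generalize riccatiWeight σ t = W
    set u := ‖g t‖
    set v := ‖g' t‖
    have hI : -(2 * W * I) ≤ 2 * |W| * (u * v) := by
      have := neg_abs_le (W * I)
      have h2 : |W * I| ≤ |W| * (u * v) := by
        rw [abs_mul]; exact mul_le_mul_of_nonneg_left (abs_le.2 hi) (abs_nonneg _)
      linarith
    have hsq : 2 * |W| * (u * v) ≤ P⁻¹ * W ^ 2 * u ^ 2 + P * v ^ 2 := by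
      have h3 : P⁻¹ * W ^ 2 * u ^ 2 + P * v ^ 2 - 2 * |W| * (u * v)
          = P⁻¹ * (|W| * u - P * v) ^ 2 := by
        rw [← sq_abs W]; field_simp; ring
      have : 0 ≤ P⁻¹ * (|W| * u - P * v) ^ 2 := by positivity
      linarith
    nlinarith

theorem extConst_mul_le_lintegral_Ioi {σ : ℝ} (hσ0 : 0 < σ) (hσ1 : σ < 1) {g g' : ℝ → ℂ}
    (hg : ∀ t, HasDerivAt g (g' t) t) (hg' : Continuous g') {T : ℝ} (hT : 0 ≤ T) (hgT : g T = 0) :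
    ENNReal.ofReal (extConst σ * ‖g 0‖ ^ 2) ≤
      ∫⁻ t in Ioi (0 : ℝ), ENNReal.ofReal (|t| ^ (1 - 2 * σ) * (‖g t‖ ^ 2 + ‖g' t‖ ^ 2)) := by
  have hgc : Continuous g := continuous_iff_continuousAt.2 fun t => (hg t).continuousAt
  refine (ENNReal.ofReal_le_ofReal (extConst_mul_le_integral hσ0 hσ1 hg hg' hT hgT)).trans ?_
  have hi := intervalIntegrable_abs_rpow_mul (a := 1 - 2 * σ) (by linarith)
    (h := fun t => ‖g t‖ ^ 2 + ‖g' t‖ ^ 2) (by fun_prop) 0 T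
  rw [intervalIntegral.integral_of_le hT, ofReal_integral_eq_lintegral_ofReal hi.1
    (ae_of_all _ fun t => by positivity)]
  exact lintegral_mono_set Ioc_subset_Ioi_self

theorem lintegral_eq_lintegral_Ioi_add (f : ℝ → ℝ≥0∞) :
    ∫⁻ t, f t = (∫⁻ t in Ioi 0, f t) + ∫⁻ t in Ioi 0, f (-t) := by
  have h1 : ∫⁻ t in Ioi (0 : ℝ), f (-t) = ∫⁻ t in Iio 0, f t := by
    have := (Measure.measurePreserving_neg (volume : Measure ℝ)).setLIntegral_comp_preimage_emb
      (MeasurableEquiv.neg ℝ).measurableEmbedding f (Iio 0)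
    simpa using this
  rw [h1, ← lintegral_add_compl f measurableSet_Ioi, compl_Ioi, setLIntegral_congr Iio_ae_eq_Iic]

/-- The factor `2` comes from applying the half-line inequality to `g(t)` and to `g(-t)`. -/
theorem two_extConst_mul_le_lintegral {σ : ℝ} (hσ0 : 0 < σ) (hσ1 : σ < 1) {g g' : ℝ → ℂ}
    (hg : ∀ t, HasDerivAt g (g' t) t) (hg' : Continuous g') (hgs : HasCompactSupport g) :
    ENNReal.ofReal (2 * extConst σ) * ‖g 0‖ₑ ^ 2 ≤
      ∫⁻ t, ENNReal.ofReal (|t| ^ (1 - 2 * σ)) * (‖g t‖ₑ ^ 2 + ‖g' t‖ₑ ^ 2) := by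
  obtain ⟨T, hT, hTs⟩ := hgs.isCompact.isBounded.subset_closedBall_lt 0 0
  have hz : ∀ t, T < |t| → g t = 0 := by
    intro t ht
    refine image_eq_zero_of_notMem_tsupport fun hmem => ?_
    have := hTs hmem
    rw [Metric.mem_closedBall, dist_zero_right, Real.norm_eq_abs] at this
    linarith
  have h1 := extConst_mul_le_lintegral_Ioi hσ0 hσ1 hg hg' (T := T + 1) (by linarith)
    (hz _ (by rw [abs_of_pos (by linarith)]; linarith))
  have h2 := extConst_mul_le_lintegral_Ioi hσ0 hσ1 (g := fun t => g (-t)) (g' := fun t => -g' (-t))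
    (fun t => by simpa [Function.comp_def] using (hg (-t)).scomp t (hasDerivAt_neg t)) (by fun_prop) (T := T + 1)
    (by linarith) (hz _ (by rw [abs_neg, abs_of_pos (by linarith)]; linarith))
  have hc : ∀ t, ENNReal.ofReal (|t| ^ (1 - 2 * σ)) * (‖g t‖ₑ ^ 2 + ‖g' t‖ₑ ^ 2)
      = ENNReal.ofReal (|t| ^ (1 - 2 * σ) * (‖g t‖ ^ 2 + ‖g' t‖ ^ 2)) := by
    intro t
    rw [ENNReal.ofReal_mul (by positivity), ENNReal.ofReal_add (by positivity) (by positivity),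
      ENNReal.ofReal_pow (norm_nonneg _), ENNReal.ofReal_pow (norm_nonneg _), ofReal_norm,
      ofReal_norm]
  have hN := extConst_nonneg hσ0 hσ1
  simp only [hc]
  rw [lintegral_eq_lintegral_Ioi_add]
  simp only [abs_neg, norm_neg, neg_zero] at h2 ⊢
  refine le_trans (le_of_eq ?_) (add_le_add h1 h2)
  rw [← ENNReal.ofReal_add (by positivity) (by positivity), ← ofReal_norm,
    ← ENNReal.ofReal_pow (norm_nonneg _), ← ENNReal.ofReal_mul (by positivity)]
  congr 1; ring

/-- Scaling of the one-dimensional weighted energy. -/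
theorem lintegral_abs_rpow_comp_mul (a : ℝ) (F : ℝ → ℝ≥0∞) {k : ℝ} (hk : 0 < k) :
    ∫⁻ t, ENNReal.ofReal (|t| ^ a) * F (k * t) =
      ENNReal.ofReal (k ^ (-1 - a)) * ∫⁻ t, ENNReal.ofReal (|t| ^ a) * F t := by
  have h := lintegral_comp_smul (volume : Measure ℝ) (fun t => ENNReal.ofReal (|t| ^ a) * F t) hk.ne'
  simp only [Module.finrank_self, pow_one, smul_eq_mul] at h
  rw [abs_of_pos (by positivity)] at h
  have e : ∀ t, ENNReal.ofReal (|t| ^ a) * F (k * t)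
      = ENNReal.ofReal (k ^ (-a)) * (ENNReal.ofReal (|k * t| ^ a) * F (k * t)) := by
    intro t
    rw [← mul_assoc, ← ENNReal.ofReal_mul (by positivity), abs_mul, abs_of_pos hk,
      Real.mul_rpow hk.le (abs_nonneg _), ← mul_assoc, ← Real.rpow_add hk]
    simp
  simp only [e]
  rw [lintegral_const_mul' _ _ ENNReal.ofReal_ne_top, h, ← mul_assoc,
    ← ENNReal.ofReal_mul (by positivity)]
  congr 2
  rw [← Real.rpow_neg_one, ← Real.rpow_add hk]
  congr 1; ring

/-- Apply the case `k = 1` to `t ↦ g(t/k)`: the weight and `dt` scale by `k^(2σ-2)`, and multiplying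
by `k²` leaves `k^(2σ)`. For `k = 0` the left side vanishes. -/
theorem two_extConst_mul_rpow_le_lintegral {σ : ℝ} (hσ0 : 0 < σ) (hσ1 : σ < 1) {g g' : ℝ → ℂ}
    (hg : ∀ t, HasDerivAt g (g' t) t) (hg' : Continuous g') (hgs : HasCompactSupport g)
    {k : ℝ} (hk : 0 ≤ k) :
    ENNReal.ofReal (2 * extConst σ) * (ENNReal.ofReal (k ^ (2 * σ)) * ‖g 0‖ₑ ^ 2) ≤
      ∫⁻ t, ENNReal.ofReal (|t| ^ (1 - 2 * σ)) *
        (ENNReal.ofReal (k ^ 2) * ‖g t‖ₑ ^ 2 + ‖g' t‖ₑ ^ 2) := by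
  rcases eq_or_lt_of_le hk with rfl | hk
  · simp [Real.zero_rpow (by positivity : 2 * σ ≠ 0)]
  have hc : Continuous fun t : ℝ => k⁻¹ * t := by fun_prop
  have h := two_extConst_mul_le_lintegral hσ0 hσ1 (g := fun t => g (k⁻¹ * t))
    (g' := fun t => k⁻¹ • g' (k⁻¹ * t))
    (fun t => (hg (k⁻¹ * t)).scomp t (by simpa using (hasDerivAt_id t).const_mul k⁻¹))
    (by fun_prop)
    (hgs.comp_homeomorph (Homeomorph.mulLeft₀ k⁻¹ (by positivity)))
  have e := lintegral_abs_rpow_comp_mul (1 - 2 * σ)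
    (fun t => ‖g (k⁻¹ * t)‖ₑ ^ 2 + ‖k⁻¹ • g' (k⁻¹ * t)‖ₑ ^ 2) hk
  have hk2 : ENNReal.ofReal (k ^ 2) * ‖k⁻¹‖ₑ ^ 2 = 1 := by
    rw [Real.enorm_eq_ofReal (by positivity), ← ENNReal.ofReal_pow (by positivity),
      ← ENNReal.ofReal_mul (by positivity), ← mul_pow, mul_inv_cancel₀ hk.ne']
    simp
  calc ENNReal.ofReal (2 * extConst σ) * (ENNReal.ofReal (k ^ (2 * σ)) * ‖g 0‖ₑ ^ 2)
      = ENNReal.ofReal (k ^ 2) * (ENNReal.ofReal (k ^ (-1 - (1 - 2 * σ))) *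
        (ENNReal.ofReal (2 * extConst σ) * ‖g (k⁻¹ * 0)‖ₑ ^ 2)) := by
        rw [← mul_assoc (ENNReal.ofReal (k ^ 2)), ← ENNReal.ofReal_mul (by positivity),
          ← Real.rpow_natCast, ← Real.rpow_add hk]
        have : ((2 : ℕ) : ℝ) + (-1 - (1 - 2 * σ)) = 2 * σ := by push_cast; ring
        rw [this, mul_zero]; ring
    _ ≤ ENNReal.ofReal (k ^ 2) * (ENNReal.ofReal (k ^ (-1 - (1 - 2 * σ))) *
        ∫⁻ t, ENNReal.ofReal (|t| ^ (1 - 2 * σ)) *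
          (‖g (k⁻¹ * t)‖ₑ ^ 2 + ‖k⁻¹ • g' (k⁻¹ * t)‖ₑ ^ 2)) := by gcongr
    _ = _ := by
        rw [← e, ← lintegral_const_mul' _ _ ENNReal.ofReal_ne_top]
        refine lintegral_congr fun t => ?_
        rw [inv_mul_cancel_left₀ hk.ne', enorm_smul, mul_pow]
        calc _ = ENNReal.ofReal (|t| ^ (1 - 2 * σ)) * (ENNReal.ofReal (k ^ 2) * ‖g t‖ₑ ^ 2
                + (ENNReal.ofReal (k ^ 2) * ‖k⁻¹‖ₑ ^ 2) * ‖g' t‖ₑ ^ 2) := by ring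
          _ = _ := by rw [hk2, one_mul]

end FracCapacity

/-! ### Partial Fourier transform of a competitor and the lower bound. -/

namespace FracCapacity

open MeasureTheory Set FourierTransform

theorem fderiv_slice_apply {E F : Type*} [NormedAddCommGroup E] [NormedSpace ℝ E]
    [NormedAddCommGroup F] [NormedSpace ℝ F] {G : E × ℝ → F} {x : E} {t : ℝ}
    (hG : DifferentiableAt ℝ G (x, t)) (v : E) :
    fderiv ℝ (fun x => G (x, t)) x v = fderiv ℝ G (x, t) (v, 0) := by
  have h : HasFDerivAt (fun x => G (x, t)) ((fderiv ℝ G (x, t)).comp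
      (ContinuousLinearMap.inl ℝ E ℝ)) x :=
    HasFDerivAt.comp (g := G) (f := fun x => (x, t)) x hG.hasFDerivAt (hasFDerivAt_prodMk_left x t)
  rw [h.fderiv]
  simp

theorem hasDerivAt_slice {E F : Type*} [NormedAddCommGroup E] [NormedSpace ℝ E]
    [NormedAddCommGroup F] [NormedSpace ℝ F] {G : E × ℝ → F} {x : E} {t : ℝ}
    (hG : DifferentiableAt ℝ G (x, t)) :
    HasDerivAt (fun t => G (x, t)) (fderiv ℝ G (x, t) (0, 1)) t := by
  have h : HasFDerivAt (fun t => G (x, t)) ((fderiv ℝ G (x, t)).comp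
      (ContinuousLinearMap.inr ℝ E ℝ)) t :=
    HasFDerivAt.comp (g := G) (f := fun t => (x, t)) t hG.hasFDerivAt (hasFDerivAt_prodMk_right x t)
  simpa using h.hasDerivAt

theorem gradSq_eq {n : ℕ} {G : EuclideanSpace ℝ (Fin n) × ℝ → ℝ}
    {X : EuclideanSpace ℝ (Fin n) × ℝ} (hG : DifferentiableAt ℝ G X) :
    gradSq G X = (∑ i, (fderiv ℝ G X (EuclideanSpace.single i 1, 0)) ^ 2)
      + (fderiv ℝ G X (0, 1)) ^ 2 := by
  obtain ⟨x, t⟩ := X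
  rw [gradSq, (hasDerivAt_slice hG).deriv, EuclideanSpace.real_norm_sq_eq]
  congr 1
  refine Finset.sum_congr rfl fun i _ => ?_
  rw [← fderiv_slice_apply hG]
  congr 1
  have := EuclideanSpace.inner_single_right (𝕜 := ℝ) i 1 (gradient (fun x => G (x, t)) x)
  rw [gradient, InnerProductSpace.toDual_symm_apply] at this
  simpa [gradient] using this.symm

/-- Tonelli with `t` outermost and the gradient split into coordinates, so that Plancherel in `x`
applies to each directional derivative on each slice. -/
theorem weightedEnergy_eq {n : ℕ} (σ : ℝ) {G : EuclideanSpace ℝ (Fin n) × ℝ → ℝ}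
    (hG : ContDiff ℝ 1 G) :
    weightedEnergy σ G = ∫⁻ t, ENNReal.ofReal (|t| ^ (1 - 2 * σ)) *
      ((∑ i, ∫⁻ x, ‖fderiv ℝ G (x, t) (EuclideanSpace.single i 1, 0)‖ₑ ^ 2)
        + ∫⁻ x, ‖fderiv ℝ G (x, t) (0, 1)‖ₑ ^ 2) := by
  have hc : ∀ v, Continuous fun X => fderiv ℝ G X v := fun v =>
    (hG.continuous_fderiv one_ne_zero).clm_apply continuous_const
  have e : ∀ X : EuclideanSpace ℝ (Fin n) × ℝ, ENNReal.ofReal (|X.2| ^ (1 - 2 * σ) * gradSq G X)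
      = ENNReal.ofReal (|X.2| ^ (1 - 2 * σ)) *
      ((∑ i, ‖fderiv ℝ G X (EuclideanSpace.single i 1, 0)‖ₑ ^ 2)
        + ‖fderiv ℝ G X (0, 1)‖ₑ ^ 2) := by
    intro X
    have h : ∀ r : ℝ, ENNReal.ofReal (r ^ 2) = ‖r‖ₑ ^ 2 := fun r => by
      rw [← ofReal_norm, ← ENNReal.ofReal_pow (norm_nonneg _), Real.norm_eq_abs, sq_abs]
    rw [ENNReal.ofReal_mul (by positivity), gradSq_eq (hG.differentiable one_ne_zero X),
      ENNReal.ofReal_add (by positivity) (by positivity),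
      ENNReal.ofReal_sum_of_nonneg (fun _ _ => by positivity)]
    simp only [h]
  have hm : ∀ v, Measurable fun X => ‖fderiv ℝ G X v‖ₑ ^ 2 := fun v =>
    (hc v).measurable.enorm.pow_const 2
  have hm' : ∀ v t, Measurable fun x => ‖fderiv ℝ G (x, t) v‖ₑ ^ 2 := fun v t =>
    (hm v).comp measurable_prodMk_right
  rw [weightedEnergy]
  simp only [e]
  rw [Measure.volume_eq_prod, lintegral_prod_symm]
  · refine lintegral_congr fun t => ?_
    dsimp only
    rw [lintegral_const_mul' _ _ ENNReal.ofReal_ne_top, lintegral_add_right _ (hm' _ _),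
      lintegral_finsetSum _ (fun i _ => hm' _ _)]
  · refine Measurable.aemeasurable (Measurable.mul (by fun_prop) (Measurable.add ?_ (hm _)))
    exact Finset.measurable_fun_sum _ fun i _ => hm _

theorem hasCompactSupport_slice {E : Type*} [NormedAddCommGroup E] {H : E × ℝ → ℂ} (hHs : HasCompactSupport H) (t : ℝ) :
    HasCompactSupport fun x => H (x, t) :=
  HasCompactSupport.of_support_subset_isCompact (hHs.isCompact.image continuous_fst)
    fun x hx => ⟨(x, t), subset_tsupport H hx, rfl⟩

section Slices

variable {E : Type*} [NormedAddCommGroup E] [InnerProductSpace ℝ E] [FiniteDimensional ℝ E]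
  [MeasurableSpace E] [BorelSpace E]

/-- A constant on the projection of the support dominates all slices at once, as needed to pass
limits and `t`-derivatives under the partial transform. -/
theorem exists_integrable_bound {H : E × ℝ → ℂ} (hH : Continuous H) (hHs : HasCompactSupport H) :
    ∃ b : E → ℝ, Integrable b ∧ ∀ x t, ‖H (x, t)‖ ≤ b x := by
  obtain ⟨C, hC⟩ := hHs.exists_bound_of_continuous hH
  have hK : IsCompact (Prod.fst '' tsupport H) := hHs.isCompact.image continuous_fst
  refine ⟨(Prod.fst '' tsupport H).indicator fun _ => C, ?_, fun x t => ?_⟩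
  · rw [integrable_indicator_iff hK.measurableSet]
    exact integrableOn_const hK.measure_ne_top
  · by_cases hx : x ∈ Prod.fst '' tsupport H
    · rw [indicator_of_mem hx]; exact hC _
    · rw [indicator_of_notMem hx, image_eq_zero_of_notMem_tsupport fun h => hx ⟨_, h, rfl⟩, norm_zero]

theorem continuous_fourier_slice {H : E × ℝ → ℂ} (hH : Continuous H) (hHs : HasCompactSupport H) :
    Continuous fun p : E × ℝ => 𝓕 (fun x => H (x, p.2)) p.1 := by
  obtain ⟨b, hb, hHb⟩ := exists_integrable_bound hH hHs
  simp only [Real.fourier_eq']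
  refine continuous_of_dominated (fun p => ?_) (fun p => ae_of_all _ fun x => ?_) hb
    (ae_of_all _ fun x => by fun_prop)
  · exact Continuous.aestronglyMeasurable (by fun_prop)
  · rw [norm_smul, Complex.norm_exp_ofReal_mul_I, one_mul]
    exact hHb x p.2

theorem hasDerivAt_fourier_slice {H H' : E × ℝ → ℂ} (hH : Continuous H) (hHs : HasCompactSupport H)
    (hH' : Continuous H') (hHs' : HasCompactSupport H')
    (hd : ∀ x t, HasDerivAt (fun t => H (x, t)) (H' (x, t)) t) (ξ : E) (t : ℝ) :
    HasDerivAt (fun t => 𝓕 (fun x => H (x, t)) ξ) (𝓕 (fun x => H' (x, t)) ξ) t := by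
  obtain ⟨b, hb, hHb⟩ := exists_integrable_bound hH' hHs'
  obtain ⟨b0, hb0, hHb0⟩ := exists_integrable_bound hH hHs
  simp only [Real.fourier_eq']
  have hn : ∀ (x : E) (z : ℂ),
      ‖Complex.exp ((↑(-2 * Real.pi * inner ℝ x ξ) : ℂ) * Complex.I) • z‖ = ‖z‖ := fun x z => by
    rw [norm_smul, Complex.norm_exp_ofReal_mul_I, one_mul]
  refine (hasDerivAt_integral_of_dominated_loc_of_deriv_le (μ := (volume : Measure E))
    (F := fun t x => Complex.exp ((↑(-2 * Real.pi * inner ℝ x ξ) : ℂ) * Complex.I) • H (x, t))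
    (F' := fun t x => Complex.exp ((↑(-2 * Real.pi * inner ℝ x ξ) : ℂ) * Complex.I) • H' (x, t))
    (s := univ) Filter.univ_mem (Filter.Eventually.of_forall fun t => ?_) ?_ ?_
    (ae_of_all _ fun x t _ => ?_) hb (ae_of_all _ fun x t _ => ?_)).2
  · exact Continuous.aestronglyMeasurable (by fun_prop)
  · refine hb0.mono' (Continuous.aestronglyMeasurable (by fun_prop)) (ae_of_all _ fun x => ?_)
    rw [hn]; exact hHb0 x t
  · exact Continuous.aestronglyMeasurable (by fun_prop)
  · rw [hn]; exact hHb x t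
  · exact (hd x t).const_mul _

theorem fourier_fderiv_apply {u : E → ℂ} (hu : ContDiff ℝ 1 u) (hus : HasCompactSupport u)
    (v ξ : E) :
    𝓕 (fun x => fderiv ℝ u x v) ξ = (2 * Real.pi * Complex.I * (inner ℝ ξ v : ℝ)) * 𝓕 u ξ := by
  have hi : Integrable (fderiv ℝ u) :=
    (hu.continuous_fderiv one_ne_zero).integrable_of_hasCompactSupport (hus.fderiv ℝ)
  have h := Real.fourier_fderiv (hu.continuous.integrable_of_hasCompactSupport hus)
    (hu.differentiable one_ne_zero) hi
  have h2 := Real.fourier_continuousLinearMap_apply (f := fderiv ℝ u) (a := v) (v := ξ) hi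
  rw [← h2, h]
  rw [VectorFourier.fourierSMulRight_apply]
  change -(2 * (Real.pi : ℂ) * Complex.I) • ((-(inner ℝ ξ v) : ℝ) • 𝓕 u ξ) = _
  rw [Complex.real_smul, smul_eq_mul]
  push_cast
  ring

theorem lintegral_enorm_fderiv_apply_sq {u : E → ℂ} (hu : ContDiff ℝ 1 u)
    (hus : HasCompactSupport u) (v : E) :
    ∫⁻ x, ‖fderiv ℝ u x v‖ₑ ^ 2 =
      ∫⁻ ξ, ENNReal.ofReal ((2 * Real.pi * inner ℝ ξ v) ^ 2) * ‖𝓕 u ξ‖ₑ ^ 2 := by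
  have hc : Continuous fun x => fderiv ℝ u x v :=
    (hu.continuous_fderiv one_ne_zero).clm_apply continuous_const
  have hs : HasCompactSupport fun x => fderiv ℝ u x v := hus.fderiv_apply ℝ v
  rw [← lintegral_enorm_fourier_sq (hc.integrable_of_hasCompactSupport hs)
    (hc.memLp_of_hasCompactSupport hs)]
  refine lintegral_congr fun ξ => ?_
  rw [fourier_fderiv_apply hu hus, enorm_mul, mul_pow]
  congr 1
  rw [← ofReal_norm, ← ENNReal.ofReal_pow (norm_nonneg _)]
  congr 1
  simp [mul_pow, abs_of_pos Real.pi_pos]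

end Slices

theorem sum_ofReal_inner_single_sq {n : ℕ} (ξ : EuclideanSpace ℝ (Fin n)) :
    ∑ i, ENNReal.ofReal ((2 * Real.pi * inner ℝ ξ (EuclideanSpace.single i 1)) ^ 2) =
      ENNReal.ofReal ((2 * Real.pi * ‖ξ‖) ^ 2) := by
  rw [← ENNReal.ofReal_sum_of_nonneg (fun _ _ => by positivity)]
  congr 1
  simp only [mul_pow, ← Finset.mul_sum, EuclideanSpace.real_norm_sq_eq,
    EuclideanSpace.inner_single_right]
  simp

theorem sum_lintegral_ofReal_inner_single_sq_mul {n : ℕ} {w : EuclideanSpace ℝ (Fin n) → ℝ≥0∞}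
    (hw : Measurable w) :
    ∑ i, ∫⁻ ξ, ENNReal.ofReal ((2 * Real.pi * inner ℝ ξ (EuclideanSpace.single i 1)) ^ 2) * w ξ =
      ∫⁻ ξ, ENNReal.ofReal ((2 * Real.pi * ‖ξ‖) ^ 2) * w ξ := by
  rw [← lintegral_finsetSum _ (fun i _ => by fun_prop)]
  refine lintegral_congr fun ξ => ?_
  rw [← Finset.sum_mul, sum_ofReal_inner_single_sq]

/-- Plancherel turns `∂_i` into multiplication by `2πi ξ_i`, and the squares sum to `(2π‖ξ‖)²`.
After exchanging the integrals, the one-dimensional inequality with `k = 2π‖ξ‖` applies for each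
`ξ`. -/
theorem mul_fourierEnergy_le_weightedEnergy {n : ℕ} {σ : ℝ} (hσ0 : 0 < σ) (hσ1 : σ < 1)
    {G : EuclideanSpace ℝ (Fin n) × ℝ → ℝ} (hG : ContDiff ℝ ∞ G) (hGs : HasCompactSupport G) :
    ENNReal.ofReal (2 * extConst σ) * fourierEnergy σ (fun x => G (x, 0)) ≤ weightedEnergy σ G := by
  set H : EuclideanSpace ℝ (Fin n) × ℝ → ℂ := fun X => (G X : ℂ) with hH
  have hHd : ContDiff ℝ ∞ H := Complex.ofRealCLM.contDiff.comp hG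
  have hHs : HasCompactSupport H := hGs.comp_left (g := fun r : ℝ => (r : ℂ)) (by simp)
  have hH1 : ContDiff ℝ 1 H := hHd.of_le (by norm_cast)
  have hG1 : ContDiff ℝ 1 G := hG.of_le (by norm_cast)
  have hfd : ∀ X v, ((fderiv ℝ G X v : ℝ) : ℂ) = fderiv ℝ H X v := fun X v => by
    have := (Complex.ofRealCLM.hasFDerivAt.comp X (hG1.differentiable one_ne_zero X).hasFDerivAt)
    rw [show fderiv ℝ H X = _ from this.fderiv]
    simp
  have hc : ∀ v, Continuous fun X => fderiv ℝ H X v := fun v =>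
    (hH1.continuous_fderiv one_ne_zero).clm_apply continuous_const
  have hcs : ∀ v, HasCompactSupport fun X => fderiv ℝ H X v := fun v => hHs.fderiv_apply ℝ v
  have hslice : ∀ t, ContDiff ℝ 1 fun x => H (x, t) := fun t => by fun_prop
  have hx : ∀ x t v, fderiv ℝ H (x, t) (v, 0) = fderiv ℝ (fun x => H (x, t)) x v := fun x t v =>
    (fderiv_slice_apply (hH1.differentiable one_ne_zero (x, t)) v).symm
  have ht : ∀ x t, HasDerivAt (fun t => H (x, t)) (fderiv ℝ H (x, t) (0, 1)) t := fun x t =>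
    hasDerivAt_slice (hH1.differentiable one_ne_zero (x, t))
  have hen : ∀ X v, ‖fderiv ℝ G X v‖ₑ = ‖fderiv ℝ H X v‖ₑ := fun X v => by
    rw [← hfd, ← ofReal_norm, ← ofReal_norm, Complex.norm_real]
  obtain ⟨g, hg⟩ : ∃ g : EuclideanSpace ℝ (Fin n) → ℝ → ℂ,
    ∀ ξ t, g ξ t = 𝓕 (fun x => H (x, t)) ξ := ⟨_, fun _ _ => rfl⟩
  obtain ⟨g', hg'⟩ : ∃ g' : EuclideanSpace ℝ (Fin n) → ℝ → ℂ,
    ∀ ξ t, g' ξ t = 𝓕 (fun x => fderiv ℝ H (x, t) (0, 1)) ξ := ⟨_, fun _ _ => rfl⟩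
  have hgc : Continuous fun p : EuclideanSpace ℝ (Fin n) × ℝ => g p.1 p.2 := by
    simp only [hg]
    exact continuous_fourier_slice hH1.continuous hHs
  have hgc' : Continuous fun p : EuclideanSpace ℝ (Fin n) × ℝ => g' p.1 p.2 := by
    simp only [hg']
    exact continuous_fourier_slice (hc _) (hcs _)
  have henergy : weightedEnergy σ G = ∫⁻ t, ∫⁻ ξ, ENNReal.ofReal (|t| ^ (1 - 2 * σ)) *
      (ENNReal.ofReal ((2 * Real.pi * ‖ξ‖) ^ 2) * ‖g ξ t‖ₑ ^ 2 + ‖g' ξ t‖ₑ ^ 2) := by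
    rw [weightedEnergy_eq σ hG1]
    refine lintegral_congr fun t => ?_
    have hct : Continuous fun x => fderiv ℝ H (x, t) (0, 1) := (hc (0, 1)).comp (by fun_prop)
    have hst := hasCompactSupport_slice (hcs (0, 1)) t
    have hgt : Measurable fun ξ => g ξ t := hgc.comp (by fun_prop : Continuous fun ξ => (ξ, t)) |>.measurable
    have hgt' : Measurable fun ξ => g' ξ t :=
      hgc'.comp (by fun_prop : Continuous fun ξ => (ξ, t)) |>.measurable
    rw [lintegral_const_mul' _ _ ENNReal.ofReal_ne_top, lintegral_add_right _ (by fun_prop)]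
    simp only [hen]
    simp only [hg', hg]
    rw [lintegral_enorm_fourier_sq (hct.integrable_of_hasCompactSupport hst)
      (hct.memLp_of_hasCompactSupport hst)]
    congr 2
    simp only [hx, lintegral_enorm_fderiv_apply_sq (hslice t) (hasCompactSupport_slice hHs t)]
    simp only [hg] at hgt
    exact sum_lintegral_ofReal_inner_single_sq_mul (hgt.enorm.pow_const 2)
  rw [henergy, lintegral_lintegral_swap, fourierEnergy_eq, ← lintegral_const_mul' _ _
    ENNReal.ofReal_ne_top]
  · refine lintegral_mono fun ξ => ?_
    have hd := hasDerivAt_fourier_slice hH1.continuous hHs (hc _) (hcs _) ht ξ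
    simp only [← hg, ← hg'] at hd
    rw [show 𝓕 (fun x => ((G (x, 0) : ℝ) : ℂ)) ξ = g ξ 0 from (hg ξ 0).symm]
    refine two_extConst_mul_rpow_le_lintegral hσ0 hσ1 (g := g ξ) (g' := g' ξ)
      hd (hgc'.comp (by fun_prop : Continuous fun t => (ξ, t))) ?_ (by positivity)
    -- For `t` outside the projection of the support of `H` the whole slice is zero, hence so is its
    -- transform.
    refine HasCompactSupport.of_support_subset_isCompact (hHs.isCompact.image continuous_snd)
      fun t hgt => ?_
    by_contra hmem
    refine hgt ?_
    have : (fun x => H (x, t)) = 0 := by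
      funext x
      exact image_eq_zero_of_notMem_tsupport fun h => hmem ⟨_, h, rfl⟩
    simp only [hg, this]
    rw [Real.fourier_eq']
    simp
  · have h1 : Continuous fun p : ℝ × EuclideanSpace ℝ (Fin n) => g p.2 p.1 :=
      hgc.comp continuous_swap
    have h2 : Continuous fun p : ℝ × EuclideanSpace ℝ (Fin n) => g' p.2 p.1 :=
      hgc'.comp continuous_swap
    have h1 := h1.measurable.enorm.pow_const 2
    have h2 := h2.measurable.enorm.pow_const 2
    exact (Measurable.mul (by fun_prop) ((Measurable.mul (by fun_prop) h1).add h2)).aemeasurable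

end FracCapacity

/-! ### Energy of the Gaussian mixture, computed exactly. -/

namespace FracCapacity

open MeasureTheory Set

/-- The measure `e^{-s} s^{σ-1} ds` on the positive half-line. -/
noncomputable def gammaWeight (σ : ℝ) : Measure ℝ :=
  (volume.restrict (Ioi (0 : ℝ))).withDensity
    fun s => ENNReal.ofReal (Real.exp (-s) * s ^ (σ - 1))

theorem lintegral_gammaWeight (σ : ℝ) {f : ℝ → ℝ≥0∞} (hf : Measurable f) :
    ∫⁻ s, f s ∂gammaWeight σ =
      ∫⁻ s in Ioi (0 : ℝ), ENNReal.ofReal (Real.exp (-s) * s ^ (σ - 1)) * f s := by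
  rw [gammaWeight, lintegral_withDensity_eq_lintegral_mul _ (by fun_prop) hf]
  rfl

theorem gammaWeight_univ {σ : ℝ} (hσ : 0 < σ) :
    gammaWeight σ univ = ENNReal.ofReal (Real.Gamma σ) := by
  rw [gammaWeight, withDensity_apply _ MeasurableSet.univ, Measure.restrict_univ,
    Real.Gamma_eq_integral hσ, ofReal_integral_eq_lintegral_ofReal (Real.GammaIntegral_convergent hσ)]
  filter_upwards [ae_restrict_mem measurableSet_Ioi] with s hs
  have hs : 0 < s := hs
  simp only [Pi.zero_apply]
  positivity

theorem isFiniteMeasure_gammaWeight {σ : ℝ} (hσ : 0 < σ) : IsFiniteMeasure (gammaWeight σ) :=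
  ⟨by rw [gammaWeight_univ hσ]; exact ENNReal.ofReal_lt_top⟩

instance (σ : ℝ) : SFinite (gammaWeight σ) := by
  rw [gammaWeight]; infer_instance

theorem ae_gammaWeight_pos (σ : ℝ) : ∀ᵐ s ∂gammaWeight σ, 0 < s :=
  (withDensity_absolutelyContinuous _ _).ae_le (ae_restrict_mem measurableSet_Ioi)

theorem lintegral_abs_rpow_mul_exp_neg {q b : ℝ} (hq : -1 < q) (hb : 0 < b) :
    ∫⁻ t : ℝ, ENNReal.ofReal (|t| ^ q * Real.exp (-b * t ^ 2)) =
      ENNReal.ofReal (b ^ (-(q + 1) / 2) * Real.Gamma ((q + 1) / 2)) := by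
  have hΓ : 0 < Real.Gamma ((q + 1) / 2) := Real.Gamma_pos_of_pos (by linarith)
  have h := integral_rpow_mul_exp_neg_mul_rpow (p := 2) (q := q) (b := b) (by norm_num) hq hb
  have hi := integrableOn_rpow_mul_exp_neg_mul_rpow (p := 2) (s := q) (b := b) hq (by norm_num) hb
  have e : ∫⁻ t in Ioi (0 : ℝ), ENNReal.ofReal (|t| ^ q * Real.exp (-b * t ^ 2)) =
      ENNReal.ofReal (b ^ (-(q + 1) / 2) * (1 / 2) * Real.Gamma ((q + 1) / 2)) := by
    rw [← h, ofReal_integral_eq_lintegral_ofReal hi]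
    · refine setLIntegral_congr_fun measurableSet_Ioi fun t ht => ?_
      simp only [abs_of_pos (mem_Ioi.1 ht), Real.rpow_two]
    · filter_upwards [ae_restrict_mem measurableSet_Ioi] with s hs
      have hs : 0 < s := hs
      simp only [Pi.zero_apply]
      positivity
  rw [lintegral_eq_lintegral_Ioi_add]
  simp only [abs_neg, even_two.neg_pow]
  rw [e, ← ENNReal.ofReal_add (by positivity) (by positivity)]
  congr 1; ring

/-- The mixed weighted energy of two Gaussians. -/
theorem lintegral_gaussian_energy {σ : ℝ} (hσ1 : σ < 1) {s r : ℝ} (hs : 0 < s)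
    (hr : 0 < r) :
    ∫⁻ t : ℝ, ENNReal.ofReal (|t| ^ (1 - 2 * σ)) *
      (ENNReal.ofReal (Real.exp (-(t ^ 2 / (4 * s)))) *
          ENNReal.ofReal (Real.exp (-(t ^ 2 / (4 * r)))) +
        ENNReal.ofReal (|t| / (2 * s) * Real.exp (-(t ^ 2 / (4 * s)))) *
          ENNReal.ofReal (|t| / (2 * r) * Real.exp (-(t ^ 2 / (4 * r))))) =
      ENNReal.ofReal (Real.Gamma (1 - σ) * ((s + r) / (4 * (s * r))) ^ (σ - 1) *
        (1 + (1 - σ) / (s + r))) := by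
  -- `b = 1/(4s) + 1/(4r)` is the exponent of the product of the two Gaussians.
  set b := (s + r) / (4 * (s * r)) with hb
  have hb0 : 0 < b := by positivity
  have hΓ : 0 < Real.Gamma (1 - σ) := Real.Gamma_pos_of_pos (by linarith)
  have h1 := lintegral_abs_rpow_mul_exp_neg (q := 1 - 2 * σ) (by linarith) hb0
  have h2 := lintegral_abs_rpow_mul_exp_neg (q := 3 - 2 * σ) (by linarith) hb0
  have e : ∀ t : ℝ, t ≠ 0 → ENNReal.ofReal (|t| ^ (1 - 2 * σ)) *
      (ENNReal.ofReal (Real.exp (-(t ^ 2 / (4 * s)))) *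
          ENNReal.ofReal (Real.exp (-(t ^ 2 / (4 * r)))) +
        ENNReal.ofReal (|t| / (2 * s) * Real.exp (-(t ^ 2 / (4 * s)))) *
          ENNReal.ofReal (|t| / (2 * r) * Real.exp (-(t ^ 2 / (4 * r))))) =
      ENNReal.ofReal (|t| ^ (1 - 2 * σ) * Real.exp (-b * t ^ 2)) +
      ENNReal.ofReal (1 / (4 * (s * r))) *
        ENNReal.ofReal (|t| ^ (3 - 2 * σ) * Real.exp (-b * t ^ 2)) := by
    intro t ht
    have ht : 0 < |t| := abs_pos.2 ht
    have h3 : |t| ^ (3 - 2 * σ) = |t| ^ (1 - 2 * σ) * |t| ^ 2 := by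
      rw [← Real.rpow_natCast, ← Real.rpow_add ht]; congr 1; push_cast; ring
    have h4 : Real.exp (-b * t ^ 2) =
        Real.exp (-(t ^ 2 / (4 * s))) * Real.exp (-(t ^ 2 / (4 * r))) := by
      rw [← Real.exp_add, hb]; congr 1; field_simp; ring
    rw [h3, h4, ← ENNReal.ofReal_mul (by positivity), ← ENNReal.ofReal_mul (by positivity),
      ← ENNReal.ofReal_mul (by positivity), ← ENNReal.ofReal_add (by positivity) (by positivity),
      ← ENNReal.ofReal_mul (by positivity), ← ENNReal.ofReal_add (by positivity) (by positivity)]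
    congr 1
    field_simp
    ring
  have hae : ∀ᵐ t : ℝ, t ≠ 0 := by simp [ae_iff]
  rw [lintegral_congr_ae (hae.mono fun t ht => e t ht), lintegral_add_left (by fun_prop),
    lintegral_const_mul' _ _ ENNReal.ofReal_ne_top, h1, h2, ← ENNReal.ofReal_mul (by positivity)]
  have g1 : (1 - 2 * σ + 1) / 2 = 1 - σ := by ring
  have g2 : (3 - 2 * σ + 1) / 2 = (1 - σ) + 1 := by ring
  have g3 : -(1 - 2 * σ + 1) / 2 = σ - 1 := by ring
  have g4 : -(3 - 2 * σ + 1) / 2 = (σ - 1) - 1 := by ring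
  rw [g1, g2, g3, g4, Real.Gamma_add_one (by linarith), Real.rpow_sub_one hb0.ne' (σ - 1),
    ← ENNReal.ofReal_add (by positivity) (by have := sub_pos.2 hσ1; positivity)]
  congr 1
  generalize hp : b ^ (σ - 1) = p
  rw [hb]
  field_simp

/-- The integrand is the exact derivative of `-e^(-(s+r)) (s+r)^(σ-1)`, which vanishes at infinity.
-/
theorem lintegral_Ioi_exp_neg_mul_rpow {σ : ℝ} (hσ1 : σ < 1) {s : ℝ} (hs : 0 < s) :
    ∫⁻ r in Ioi (0 : ℝ), ENNReal.ofReal (Real.exp (-(s + r)) * (s + r) ^ (σ - 1) *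
      (1 + (1 - σ) / (s + r))) = ENNReal.ofReal (Real.exp (-s) * s ^ (σ - 1)) := by
  have hσ : 0 < 1 - σ := sub_pos.2 hσ1
  have hd : ∀ r ∈ Ici (0 : ℝ), HasDerivAt (fun r => -(Real.exp (-(s + r)) * (s + r) ^ (σ - 1)))
      (Real.exp (-(s + r)) * (s + r) ^ (σ - 1) * (1 + (1 - σ) / (s + r))) r := by
    intro r hr
    have hr : 0 ≤ r := hr
    have hsr : 0 < s + r := by linarith
    have h1 : HasDerivAt (fun r => s + r) 1 r := (hasDerivAt_id r).const_add s
    have h2 := h1.fun_neg.exp.mul (h1.rpow_const (p := σ - 1) (Or.inl hsr.ne'))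
    refine h2.neg.congr_deriv ?_
    rw [Real.rpow_sub_one hsr.ne' (σ - 1)]
    field_simp
    ring
  have hpos : ∀ r ∈ Ioi (0 : ℝ),
      0 ≤ Real.exp (-(s + r)) * (s + r) ^ (σ - 1) * (1 + (1 - σ) / (s + r)) := by
    intro r hr
    have hr : 0 < r := hr
    positivity
  have hlim : Filter.Tendsto (fun r => -(Real.exp (-(s + r)) * (s + r) ^ (σ - 1)))
      Filter.atTop (nhds 0) := by
    have h := tendsto_rpow_mul_exp_neg_mul_atTop_nhds_zero (σ - 1) 1 one_pos
    have h2 := (h.comp (Filter.tendsto_atTop_add_const_left _ s Filter.tendsto_id)).neg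
    simpa [Function.comp_def, mul_comm] using h2
  rw [← ofReal_integral_eq_lintegral_ofReal
    (integrableOn_Ioi_deriv_of_nonneg' hd hpos hlim)
    (ae_restrict_of_forall_mem measurableSet_Ioi hpos),
    integral_Ioi_of_hasDerivAt_of_nonneg' hd hpos hlim]
  simp

/-- The density `e^(-r) r^(σ-1)` cancels the power of `r` in the Gaussian energy, leaving a total
derivative. The inner integral is then the constant `Γ(1-σ) 4^(1-σ)`, independent of `s`, and the
outer one contributes the mass `Γ(σ)`. -/
theorem lintegral_gammaWeight_energy {σ : ℝ} (hσ0 : 0 < σ) (hσ1 : σ < 1) :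
    ∫⁻ s, ∫⁻ r, ENNReal.ofReal (Real.Gamma (1 - σ) * ((s + r) / (4 * (s * r))) ^ (σ - 1) *
        (1 + (1 - σ) / (s + r))) ∂gammaWeight σ ∂gammaWeight σ =
      ENNReal.ofReal (2 * extConst σ * Real.Gamma σ ^ 2) := by
  have hΓ : 0 < Real.Gamma (1 - σ) := Real.Gamma_pos_of_pos (by linarith)
  have hΓ' : 0 < Real.Gamma σ := Real.Gamma_pos_of_pos hσ0
  have hσ : 0 < 1 - σ := sub_pos.2 hσ1
  set K := Real.Gamma (1 - σ) * 4 ^ (1 - σ) with hK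
  have hinner : ∀ s : ℝ, 0 < s → ∫⁻ r, ENNReal.ofReal (Real.Gamma (1 - σ) *
      ((s + r) / (4 * (s * r))) ^ (σ - 1) * (1 + (1 - σ) / (s + r))) ∂gammaWeight σ =
      ENNReal.ofReal K := by
    intro s hs
    rw [lintegral_gammaWeight _ (by fun_prop)]
    have hc : ENNReal.ofReal (K * (Real.exp (-s) * s ^ (σ - 1))⁻¹) ≠ ⊤ := ENNReal.ofReal_ne_top
    have e : ∀ r ∈ Ioi (0 : ℝ), ENNReal.ofReal (Real.exp (-r) * r ^ (σ - 1)) *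
        ENNReal.ofReal (Real.Gamma (1 - σ) * ((s + r) / (4 * (s * r))) ^ (σ - 1) *
          (1 + (1 - σ) / (s + r))) =
        ENNReal.ofReal (K * (Real.exp (-s) * s ^ (σ - 1))⁻¹) *
          ENNReal.ofReal (Real.exp (-(s + r)) * (s + r) ^ (σ - 1) * (1 + (1 - σ) / (s + r))) := by
      intro r hr
      have hr : 0 < r := hr
      rw [← ENNReal.ofReal_mul (by positivity), ← ENNReal.ofReal_mul (by positivity)]
      congr 1
      rw [Real.div_rpow (by positivity) (by positivity), Real.mul_rpow (by norm_num) (by positivity),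
        Real.mul_rpow hs.le hr.le, neg_add, Real.exp_add, hK]
      have h4 : (4 : ℝ) ^ (1 - σ) = ((4 : ℝ) ^ (σ - 1))⁻¹ := by
        rw [← Real.rpow_neg (by norm_num)]; congr 1; ring
      rw [h4]
      have p1 : 0 < s ^ (σ - 1) := by positivity
      have p2 : 0 < r ^ (σ - 1) := by positivity
      have p3 : (0 : ℝ) < 4 ^ (σ - 1) := by positivity
      field_simp
    rw [setLIntegral_congr_fun measurableSet_Ioi e, lintegral_const_mul' _ _ hc,
      lintegral_Ioi_exp_neg_mul_rpow hσ1 hs, ← ENNReal.ofReal_mul (by positivity)]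
    congr 1
    field_simp
  rw [lintegral_congr_ae ((ae_gammaWeight_pos σ).mono fun s hs => hinner s hs), lintegral_const,
    gammaWeight_univ hσ0, ← ENNReal.ofReal_mul (by positivity)]
  congr 1
  have h4 : (4 : ℝ) ^ (1 - σ) = 2 * 2 ^ (1 - 2 * σ) := by
    rw [show (4 : ℝ) = 2 ^ (2 : ℝ) by norm_num, ← Real.rpow_mul (by norm_num)]
    rw [← Real.rpow_one_add' (by norm_num) (by linarith)]
    congr 1; ring
  rw [extConst, hK, h4]
  field_simp


/-! ### Truncated profiles and their energy. -/

/-- The part of the measure `e^{-s} s^{σ-1} ds` on `(ε, ∞)`. -/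
noncomputable def truncGammaWeight (σ ε : ℝ) : Measure ℝ := (gammaWeight σ).restrict (Ioi ε)

theorem isFiniteMeasure_truncGammaWeight {σ : ℝ} (hσ : 0 < σ) (ε : ℝ) :
    IsFiniteMeasure (truncGammaWeight σ ε) := by
  have := isFiniteMeasure_gammaWeight hσ
  rw [truncGammaWeight]; infer_instance

theorem ae_truncGammaWeight_lt (σ ε : ℝ) : ∀ᵐ s ∂truncGammaWeight σ ε, ε < s :=
  ae_restrict_mem measurableSet_Ioi

theorem exists_truncGammaWeight_gt {σ : ℝ} (hσ : 0 < σ) {m : ℝ} (hm : m < Real.Gamma σ) :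
    ∃ ε, 0 < ε ∧ m < (truncGammaWeight σ ε).real univ := by
  have := isFiniteMeasure_gammaWeight hσ
  have hU : ⋃ k : ℕ, Ioi (1 / ((k : ℝ) + 1)) = Ioi 0 := by
    ext s
    simp only [mem_iUnion, mem_Ioi]
    exact ⟨fun ⟨k, hk⟩ => lt_trans (by positivity) hk, fun hs => exists_nat_one_div_lt hs⟩
  have hmono : Monotone fun k : ℕ => Ioi (1 / ((k : ℝ) + 1)) := fun i j hij =>
    Ioi_subset_Ioi (by gcongr)
  have h := tendsto_measure_iUnion_atTop (μ := gammaWeight σ) hmono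
  have hfull : gammaWeight σ (Ioi 0) = ENNReal.ofReal (Real.Gamma σ) := by
    rw [← gammaWeight_univ hσ]
    exact measure_congr (Filter.eventuallyEq_univ.2 (ae_gammaWeight_pos σ))
  rw [hU, hfull] at h
  have h2 := (ENNReal.tendsto_toReal ENNReal.ofReal_ne_top).comp h
  rw [ENNReal.toReal_ofReal (Real.Gamma_pos_of_pos hσ).le] at h2
  obtain ⟨k, hk⟩ := (h2.eventually_const_lt hm).exists
  refine ⟨1 / ((k : ℝ) + 1), by positivity, ?_⟩
  simpa [truncGammaWeight, Measure.real] using hk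

/-- With `x = |t|/(2√s)` the quantity is `x e^(-x²)/√s`, and `x e^(-x²) ≤ 1`. The bound is uniform
in `t` only because `s` stays away from `0`. -/
theorem abs_div_mul_exp_le {s ε t : ℝ} (hε : 0 < ε) (hs : ε < s) :
    |t| / (2 * s) * Real.exp (-(t ^ 2 / (4 * s))) ≤ (√ε)⁻¹ := by
  have hs0 : 0 < s := hε.trans hs
  have hq : 0 < √s := Real.sqrt_pos.2 hs0
  have hx : |t| / (2 * s) = |t| / (2 * √s) * (√s)⁻¹ := by
    nth_rewrite 1 [← Real.mul_self_sqrt hs0.le]; field_simp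
  have hx2 : t ^ 2 / (4 * s) = (|t| / (2 * √s)) ^ 2 := by
    rw [div_pow, sq_abs, mul_pow, Real.sq_sqrt hs0.le]; norm_num
  rw [hx, hx2]
  generalize |t| / (2 * √s) = x
  have h1 : x * Real.exp (-x ^ 2) ≤ 1 := by
    rw [Real.exp_neg, mul_inv_le_iff₀ (Real.exp_pos _), one_mul]
    nlinarith [Real.add_one_le_exp (x ^ 2), sq_nonneg (x - 1)]
  have h2 : (√s)⁻¹ ≤ (√ε)⁻¹ := by
    have := Real.sqrt_pos.2 hε
    gcongr
  calc x * (√s)⁻¹ * Real.exp (-x ^ 2) = (x * Real.exp (-x ^ 2)) * (√s)⁻¹ := by ring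
    _ ≤ 1 * (√s)⁻¹ := by gcongr
    _ ≤ _ := by rw [one_mul]; exact h2

/-- A truncated Gaussian mixture approximating the profile `besselInt σ`. -/
noncomputable def profile (σ ε t : ℝ) : ℝ :=
  ∫ s, Real.exp (-(t ^ 2 / (4 * s))) ∂truncGammaWeight σ ε

/-- The derivative of `profile`. -/
noncomputable def profileDeriv (σ ε t : ℝ) : ℝ :=
  ∫ s, -(t / (2 * s)) * Real.exp (-(t ^ 2 / (4 * s))) ∂truncGammaWeight σ ε

theorem norm_profileDeriv_integrand {s t : ℝ} (hs : 0 < s) :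
    ‖-(t / (2 * s)) * Real.exp (-(t ^ 2 / (4 * s)))‖
      = |t| / (2 * s) * Real.exp (-(t ^ 2 / (4 * s))) := by
  rw [norm_mul, norm_neg, norm_div, Real.norm_eq_abs t, Real.norm_of_nonneg (by positivity),
    Real.norm_of_nonneg (by positivity)]

theorem norm_profileDeriv_integrand_le {s ε t : ℝ} (hε : 0 < ε) (hs : ε < s) :
    ‖-(t / (2 * s)) * Real.exp (-(t ^ 2 / (4 * s)))‖ ≤ (√ε)⁻¹ := by
  rw [norm_profileDeriv_integrand (hε.trans hs)]
  exact abs_div_mul_exp_le hε hs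

theorem hasDerivAt_profile {σ ε : ℝ} (hσ : 0 < σ) (hε : 0 < ε) (t : ℝ) :
    HasDerivAt (profile σ ε) (profileDeriv σ ε t) t := by
  have := isFiniteMeasure_truncGammaWeight hσ ε
  refine (hasDerivAt_integral_of_dominated_loc_of_deriv_le (μ := truncGammaWeight σ ε)
    (F := fun t s => Real.exp (-(t ^ 2 / (4 * s))))
    (F' := fun t s => -(t / (2 * s)) * Real.exp (-(t ^ 2 / (4 * s))))
    (bound := fun _ => (√ε)⁻¹) (s := univ) Filter.univ_mem
    (Filter.Eventually.of_forall fun t => Measurable.aestronglyMeasurable (by fun_prop)) ?_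
    (Measurable.aestronglyMeasurable (by fun_prop)) ?_ (integrable_const _) ?_).2
  · refine (integrable_const (1 : ℝ)).mono' (Measurable.aestronglyMeasurable (by fun_prop)) ?_
    filter_upwards [ae_truncGammaWeight_lt σ ε] with s hs
    have hs : 0 < s := hε.trans hs
    rw [Real.norm_of_nonneg (Real.exp_pos _).le, Real.exp_le_one_iff, neg_nonpos]
    positivity
  · filter_upwards [ae_truncGammaWeight_lt σ ε] with s hs t _
    exact norm_profileDeriv_integrand_le hε hs
  · filter_upwards [ae_truncGammaWeight_lt σ ε] with s hs t _
    have hs : 0 < s := hε.trans hs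
    have h1 : HasDerivAt (fun x : ℝ => -(x ^ 2 / (4 * s))) (-(2 * t / (4 * s))) t := by
      simpa using ((hasDerivAt_pow 2 t).div_const (4 * s)).fun_neg
    refine h1.exp.congr_deriv ?_
    field_simp
    ring

theorem continuous_profileDeriv {σ ε : ℝ} (hσ : 0 < σ) (hε : 0 < ε) :
    Continuous (profileDeriv σ ε) := by
  have := isFiniteMeasure_truncGammaWeight hσ ε
  refine continuous_of_dominated (bound := fun _ => (√ε)⁻¹)
    (fun t => Measurable.aestronglyMeasurable (by fun_prop)) (fun t => ?_) (integrable_const _)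
    (ae_of_all _ fun s => by fun_prop)
  filter_upwards [ae_truncGammaWeight_lt σ ε] with s hs
  exact norm_profileDeriv_integrand_le hε hs

theorem abs_profile_le {σ ε : ℝ} (hσ : 0 < σ) (hε : 0 < ε) (t : ℝ) :
    |profile σ ε t| ≤ (truncGammaWeight σ ε).real univ := by
  have := isFiniteMeasure_truncGammaWeight hσ ε
  have h := norm_integral_le_of_norm_le_const (μ := truncGammaWeight σ ε) (C := 1)
    (f := fun s => Real.exp (-(t ^ 2 / (4 * s)))) ?_
  · rw [one_mul] at h; exact h
  · filter_upwards [ae_truncGammaWeight_lt σ ε] with s hs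
    have hs : 0 < s := hε.trans hs
    rw [Real.norm_of_nonneg (Real.exp_pos _).le, Real.exp_le_one_iff, neg_nonpos]
    positivity

theorem abs_profileDeriv_le {σ ε : ℝ} (hσ : 0 < σ) (hε : 0 < ε) (t : ℝ) :
    |profileDeriv σ ε t| ≤ (√ε)⁻¹ * (truncGammaWeight σ ε).real univ := by
  have := isFiniteMeasure_truncGammaWeight hσ ε
  refine norm_integral_le_of_norm_le_const (μ := truncGammaWeight σ ε) (C := (√ε)⁻¹)
    (f := fun s => -(t / (2 * s)) * Real.exp (-(t ^ 2 / (4 * s)))) ?_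
  filter_upwards [ae_truncGammaWeight_lt σ ε] with s hs
  exact norm_profileDeriv_integrand_le hε hs

theorem profile_zero (σ ε : ℝ) : profile σ ε 0 = (truncGammaWeight σ ε).real univ := by
  simp [profile]

/-- The Gaussians are positive and their `t`-derivatives share one sign for fixed `t`, so removing
the truncation only increases the energy. Squares of integrals become double integrals, and Tonelli
lets the `t`-integral be done first. The derivative of the untruncated mixture never enters. -/
theorem lintegral_profile_energy_le {σ : ℝ} (hσ0 : 0 < σ) (hσ1 : σ < 1) (ε : ℝ) :
    ∫⁻ t, ENNReal.ofReal (|t| ^ (1 - 2 * σ)) *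
      (‖profile σ ε t‖ₑ ^ 2 + ‖profileDeriv σ ε t‖ₑ ^ 2) ≤
      ENNReal.ofReal (2 * extConst σ * Real.Gamma σ ^ 2) := by
  have hle : truncGammaWeight σ ε ≤ gammaWeight σ := Measure.restrict_le_self
  set a : ℝ → ℝ → ℝ≥0∞ := fun t s => ENNReal.ofReal (Real.exp (-(t ^ 2 / (4 * s)))) with ha
  set b : ℝ → ℝ → ℝ≥0∞ :=
    fun t s => ENNReal.ofReal (|t| / (2 * s) * Real.exp (-(t ^ 2 / (4 * s)))) with hb
  have ham : Measurable (Function.uncurry a) := by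
    simp only [ha, Function.uncurry_def]; fun_prop
  have hbm : Measurable (Function.uncurry b) := by
    simp only [hb, Function.uncurry_def]; fun_prop
  have h1 : ∀ t, ‖profile σ ε t‖ₑ ≤ ∫⁻ s, a t s ∂gammaWeight σ := fun t => by
    refine (enorm_integral_le_lintegral_enorm _).trans ((lintegral_mono' hle le_rfl).trans_eq ?_)
    refine lintegral_congr fun s => ?_
    rw [Real.enorm_eq_ofReal (Real.exp_pos _).le]
  have h2 : ∀ t, ‖profileDeriv σ ε t‖ₑ ≤ ∫⁻ s, b t s ∂gammaWeight σ := fun t => by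
    refine (enorm_integral_le_lintegral_enorm _).trans ((lintegral_mono' hle le_rfl).trans_eq ?_)
    refine lintegral_congr_ae ((ae_gammaWeight_pos σ).mono fun s hs => ?_)
    simp only [hb]
    rw [← norm_profileDeriv_integrand hs, ofReal_norm]
  have hsq : ∀ (c : ℝ → ℝ → ℝ≥0∞), Measurable (Function.uncurry c) → ∀ t,
      (∫⁻ s, c t s ∂gammaWeight σ) ^ 2 =
        ∫⁻ s, ∫⁻ r, c t s * c t r ∂gammaWeight σ ∂gammaWeight σ := fun c hc t => by
    have hct : Measurable (c t) := hc.comp measurable_prodMk_left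
    simp only [lintegral_const_mul _ hct]
    rw [lintegral_mul_const _ hct, sq]
  have am : ∀ t, Measurable (a t) := fun t => ham.comp measurable_prodMk_left
  have bm : ∀ t, Measurable (b t) := fun t => hbm.comp measurable_prodMk_left
  have hI : ∀ t, (∫⁻ s, a t s ∂gammaWeight σ) ^ 2 + (∫⁻ s, b t s ∂gammaWeight σ) ^ 2 =
      ∫⁻ s, ∫⁻ r, (a t s * a t r + b t s * b t r) ∂gammaWeight σ ∂gammaWeight σ := fun t => by
    rw [hsq a ham, hsq b hbm]
    rw [← lintegral_add_left]
    · refine lintegral_congr fun s => ?_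
      rw [← lintegral_add_left ((am t).const_mul _)]
    · exact Measurable.lintegral_prod_right'
        (f := fun p : ℝ × ℝ => a t p.1 * a t p.2)
        (((am t).comp measurable_fst).mul ((am t).comp measurable_snd))
  have hmt : Measurable fun p : (ℝ × ℝ) × ℝ => ENNReal.ofReal (|p.1.1| ^ (1 - 2 * σ)) *
      (a p.1.1 p.1.2 * a p.1.1 p.2 + b p.1.1 p.1.2 * b p.1.1 p.2) := by
    simp only [ha, hb]; fun_prop
  calc _ ≤ ∫⁻ t, ENNReal.ofReal (|t| ^ (1 - 2 * σ)) *
        ((∫⁻ s, a t s ∂gammaWeight σ) ^ 2 + (∫⁻ s, b t s ∂gammaWeight σ) ^ 2) := by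
        gcongr with t
        · exact h1 t
        · exact h2 t
    _ = ∫⁻ t, ∫⁻ s, ∫⁻ r, ENNReal.ofReal (|t| ^ (1 - 2 * σ)) *
        (a t s * a t r + b t s * b t r) ∂gammaWeight σ ∂gammaWeight σ := by
        refine lintegral_congr fun t => ?_
        rw [hI, ← lintegral_const_mul' _ _ ENNReal.ofReal_ne_top]
        refine lintegral_congr fun s => ?_
        rw [← lintegral_const_mul' _ _ ENNReal.ofReal_ne_top]
    _ = ∫⁻ s, ∫⁻ t, ∫⁻ r, ENNReal.ofReal (|t| ^ (1 - 2 * σ)) *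
        (a t s * a t r + b t s * b t r) ∂gammaWeight σ ∂volume ∂gammaWeight σ :=
        lintegral_lintegral_swap (Measurable.lintegral_prod_right' hmt).aemeasurable
    _ = ∫⁻ s, ∫⁻ r, ∫⁻ t, ENNReal.ofReal (|t| ^ (1 - 2 * σ)) *
        (a t s * a t r + b t s * b t r) ∂volume ∂gammaWeight σ ∂gammaWeight σ := by
        refine lintegral_congr fun s => lintegral_lintegral_swap ?_
        have : Measurable fun p : ℝ × ℝ => ((p.1, s), p.2) := by fun_prop
        exact (hmt.comp this).aemeasurable
    _ = _ := by
        rw [← lintegral_gammaWeight_energy hσ0 hσ1]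
        refine lintegral_congr_ae ((ae_gammaWeight_pos σ).mono fun s hs => ?_)
        refine lintegral_congr_ae ((ae_gammaWeight_pos σ).mono fun r hr => ?_)
        exact lintegral_gaussian_energy hσ1 hs hr


/-! ### The profile as a characteristic function. -/

open ProbabilityTheory in
/-- The mixture of Gaussians whose characteristic function is `profile σ ε`. -/
noncomputable def gaussianMixture (σ ε : ℝ) : Measure ℝ :=
  ((gaussianReal 0 1).prod (truncGammaWeight σ ε)).map fun p => p.1 * (√(2 * p.2))⁻¹

theorem isFiniteMeasure_gaussianMixture {σ : ℝ} (hσ : 0 < σ) (ε : ℝ) :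
    IsFiniteMeasure (gaussianMixture σ ε) := by
  have := isFiniteMeasure_truncGammaWeight hσ ε
  rw [gaussianMixture]; infer_instance

-- The scale factor `(2s)^(-1/2)` is bounded on `s > ε`, so the moments reduce to Gaussian ones.
-- Without the truncation, moments of order at least `2σ` would diverge.
open ProbabilityTheory in
theorem integrable_pow_gaussianMixture {σ ε : ℝ} (hσ : 0 < σ) (hε : 0 < ε) (k : ℕ) :
    Integrable (fun τ => |τ| ^ k) (gaussianMixture σ ε) := by
  have := isFiniteMeasure_truncGammaWeight hσ ε
  rw [gaussianMixture, integrable_map_measure (by fun_prop) (by fun_prop)]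
  have hg : Integrable (fun x => |x| ^ k) (gaussianReal 0 1) := by
    have h := (memLp_id_gaussianReal (μ := 0) (v := 1) (k : NNReal)).integrable_norm_rpow'
    simpa using h
  have hs : Integrable (fun s => ((√(2 * s))⁻¹) ^ k) (truncGammaWeight σ ε) := by
    refine (integrable_const (((√(2 * ε))⁻¹) ^ k)).mono'
      (Measurable.aestronglyMeasurable (by fun_prop)) ?_
    filter_upwards [ae_truncGammaWeight_lt σ ε] with s hs
    have : 0 < √(2 * ε) := by positivity
    rw [Real.norm_of_nonneg (by positivity)]
    gcongr
  refine (hg.mul_prod hs).congr (ae_of_all _ fun p => ?_)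
  simp only [Function.comp]
  rw [abs_mul, mul_pow, abs_of_nonneg (by positivity : 0 ≤ (√(2 * p.2))⁻¹)]

-- For fixed `s` the law is centred Gaussian of variance `1/(2s)`, with characteristic function
-- `e^(-t²/(4s))`; integrate over `s`.
open ProbabilityTheory in
theorem integral_exp_gaussianMixture {σ ε : ℝ} (hσ : 0 < σ) (hε : 0 < ε) (t : ℝ) :
    ∫ τ, Complex.exp (t * τ * Complex.I) ∂gaussianMixture σ ε = (profile σ ε t : ℂ) := by
  have := isFiniteMeasure_truncGammaWeight hσ ε
  rw [gaussianMixture, integral_map (by fun_prop) (by fun_prop), integral_prod_symm, profile,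
    ← integral_complex_ofReal]
  · refine integral_congr_ae ?_
    filter_upwards [ae_truncGammaWeight_lt σ ε] with s hs
    have hs : 0 < s := hε.trans hs
    have h := charFun_gaussianReal (μ := 0) (v := 1) (t * (√(2 * s))⁻¹)
    rw [charFun_apply_real] at h
    have hsq : ((√(2 * s))⁻¹) ^ 2 = (2 * s)⁻¹ := by
      rw [inv_pow, Real.sq_sqrt (by positivity)]
    calc _ = ∫ x, Complex.exp (((t * (√(2 * s))⁻¹ : ℝ) : ℂ) * x * Complex.I)
          ∂gaussianReal 0 1 := by
          refine integral_congr_ae (ae_of_all _ fun x => ?_)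
          simp only
          congr 1; push_cast; ring
      _ = _ := by
          rw [h]
          rw [Complex.ofReal_exp]
          congr 1
          have e : t ^ 2 / (4 * s) = (t * (√(2 * s))⁻¹) ^ 2 / 2 := by
            rw [mul_pow, hsq]; field_simp; norm_num
          rw [e]
          push_cast
          ring
  · refine (integrable_const (1 : ℝ)).mono' (Measurable.aestronglyMeasurable (by fun_prop))
      (ae_of_all _ fun p => ?_)
    rw [← Complex.ofReal_mul, Complex.norm_exp_ofReal_mul_I]

/-- Smooth profiles with all moments on the Fourier side, almost minimizing the weighted energy. -/
theorem exists_profile {σ : ℝ} (hσ0 : 0 < σ) (hσ1 : σ < 1) {δ : ℝ} (hδ : 0 < δ) :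
    ∃ (ν : Measure ℝ) (φ φ' : ℝ → ℝ) (C : ℝ), IsFiniteMeasure ν ∧
      (∀ k : ℕ, Integrable (fun τ => |τ| ^ k) ν) ∧
      (∀ t : ℝ, ∫ τ, Complex.exp (t * τ * Complex.I) ∂ν = (φ t : ℂ)) ∧ φ 0 = 1 ∧
      (∀ t, HasDerivAt φ (φ' t) t) ∧ Continuous φ' ∧ (∀ t, |φ t| ≤ C) ∧ (∀ t, |φ' t| ≤ C) ∧
      ∫⁻ t, ENNReal.ofReal (|t| ^ (1 - 2 * σ)) * (‖φ t‖ₑ ^ 2 + ‖φ' t‖ₑ ^ 2) ≤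
        ENNReal.ofReal ((1 + δ) * (2 * extConst σ)) := by
  have hΓ := Real.Gamma_pos_of_pos hσ0
  have hq : 0 < √(1 + δ) := by positivity
  have hq1 : 1 < √(1 + δ) := by rw [Real.lt_sqrt] <;> linarith
  -- Normalizing by the mass `c` divides the energy by `c²`; this threshold makes `(Γ(σ)/c)² ≤ 1 +
  -- δ`.
  obtain ⟨ε, hε, hm⟩ := exists_truncGammaWeight_gt hσ0 (m := Real.Gamma σ / √(1 + δ))
    (div_lt_self hΓ hq1)
  set c := (truncGammaWeight σ ε).real univ with hc
  have hc0 : 0 < c := lt_trans (by positivity) hm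
  have hfin := isFiniteMeasure_gaussianMixture hσ0 ε
  have hC : ∀ t : ℝ, ‖c⁻¹ * t‖ₑ ^ 2 = ENNReal.ofReal (c⁻¹ ^ 2) * ‖t‖ₑ ^ 2 := fun t => by
    rw [enorm_mul, mul_pow, Real.enorm_eq_ofReal (by positivity), ENNReal.ofReal_pow (by positivity)]
  refine ⟨ENNReal.ofReal c⁻¹ • gaussianMixture σ ε, fun t => c⁻¹ * profile σ ε t,
    fun t => c⁻¹ * profileDeriv σ ε t, max 1 (√ε)⁻¹,
    Measure.smul_finite _ ENNReal.ofReal_ne_top, fun k => ?_, fun t => ?_, ?_, fun t => ?_, ?_,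
    fun t => ?_, fun t => ?_, ?_⟩
  · exact (integrable_pow_gaussianMixture hσ0 hε k).smul_measure ENNReal.ofReal_ne_top
  · rw [integral_smul_measure, integral_exp_gaussianMixture hσ0 hε,
      ENNReal.toReal_ofReal (by positivity), Complex.real_smul]
    push_cast; rfl
  · dsimp only
    rw [profile_zero, ← hc, inv_mul_cancel₀ hc0.ne']
  · exact (hasDerivAt_profile hσ0 hε t).const_mul _
  · exact (continuous_profileDeriv hσ0 hε).const_mul _
  · refine le_trans ?_ (le_max_left _ _)
    rw [abs_mul, abs_of_pos (by positivity : 0 < c⁻¹), inv_mul_le_iff₀ hc0, mul_one]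
    exact abs_profile_le hσ0 hε t
  · refine le_trans ?_ (le_max_right _ _)
    rw [abs_mul, abs_of_pos (by positivity : 0 < c⁻¹), inv_mul_le_iff₀ hc0, mul_comm c]
    exact abs_profileDeriv_le hσ0 hε t
  · have e : ∀ t, ENNReal.ofReal (|t| ^ (1 - 2 * σ)) *
        (‖c⁻¹ * profile σ ε t‖ₑ ^ 2 + ‖c⁻¹ * profileDeriv σ ε t‖ₑ ^ 2) =
        ENNReal.ofReal (c⁻¹ ^ 2) * (ENNReal.ofReal (|t| ^ (1 - 2 * σ)) *
          (‖profile σ ε t‖ₑ ^ 2 + ‖profileDeriv σ ε t‖ₑ ^ 2)) := fun t => by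
      rw [hC, hC]; ring
    simp only [e]
    rw [lintegral_const_mul' _ _ ENNReal.ofReal_ne_top]
    refine (mul_le_mul_right (lintegral_profile_energy_le hσ0 hσ1 ε) _).trans ?_
    rw [← ENNReal.ofReal_mul (by positivity)]
    refine ENNReal.ofReal_le_ofReal ?_
    have h1 : Real.Gamma σ ≤ c * √(1 + δ) := by
      rw [div_lt_iff₀ hq] at hm; exact hm.le
    have h2 : (c⁻¹ * Real.Gamma σ) ^ 2 ≤ 1 + δ := by
      rw [← Real.sq_sqrt (by positivity : 0 ≤ 1 + δ)]
      have : c⁻¹ * Real.Gamma σ ≤ √(1 + δ) := by rwa [inv_mul_le_iff₀ hc0]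
      gcongr
    have hN := extConst_nonneg hσ0 hσ1
    calc c⁻¹ ^ 2 * (2 * extConst σ * Real.Gamma σ ^ 2)
        = (c⁻¹ * Real.Gamma σ) ^ 2 * (2 * extConst σ) := by ring
      _ ≤ _ := by gcongr

end FracCapacity

/-! ### Extension by a Fourier multiplier. -/

namespace FracCapacity

open MeasureTheory Set FourierTransform SchwartzMap

section Symbol

variable {E : Type*} [NormedAddCommGroup E] [InnerProductSpace ℝ E]

/-- The partial Fourier transform of the extension. -/
noncomputable def symbolMul (F : 𝓢(E, ℂ)) (φ : ℝ → ℝ) (t : ℝ) (ξ : E) : ℂ :=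
  F ξ * (φ (2 * Real.pi * ‖ξ‖ * t) : ℂ)

variable {F : 𝓢(E, ℂ)} {φ : ℝ → ℝ} {C : ℝ}

theorem continuous_symbolMul (hφ : Continuous φ) (t : ℝ) : Continuous (symbolMul F φ t) := by
  unfold symbolMul; fun_prop

/-- The factor `‖ξ‖ ^ 0` matches the hypothesis of `integrable_of_norm_le_pow_mul` with `j = 0`. -/
theorem norm_symbolMul_le (hC : ∀ t, |φ t| ≤ C) (t : ℝ) (ξ : E) :
    ‖symbolMul F φ t ξ‖ ≤ C * (‖ξ‖ ^ 0 * ‖F ξ‖) := by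
  rw [symbolMul, norm_mul, Complex.norm_real, Real.norm_eq_abs, pow_zero, one_mul, mul_comm]
  gcongr
  exact hC _

theorem norm_norm_mul_symbolMul_le (hC : ∀ t, |φ t| ≤ C) (r t : ℝ) (ξ : E) :
    ‖((r * ‖ξ‖ : ℝ) : ℂ) * symbolMul F φ t ξ‖ ≤ (|r| * C) * (‖ξ‖ ^ 1 * ‖F ξ‖) := by
  have := norm_symbolMul_le (F := F) hC t ξ
  rw [norm_mul, Complex.norm_real, norm_mul, norm_norm, Real.norm_eq_abs]
  calc |r| * ‖ξ‖ * ‖symbolMul F φ t ξ‖ ≤ |r| * ‖ξ‖ * (C * (‖ξ‖ ^ 0 * ‖F ξ‖)) := by gcongr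
    _ = _ := by ring

end Symbol

/-- The bilinear pairing on `E × ℝ`. -/
noncomputable def prodPairing (E : Type*) [NormedAddCommGroup E] [InnerProductSpace ℝ E] :
    (E × ℝ) →L[ℝ] (E × ℝ) →L[ℝ] ℝ :=
  let B : E →L[ℝ] E →L[ℝ] ℝ := innerSL ℝ
  B.bilinearComp (ContinuousLinearMap.fst ℝ E ℝ) (ContinuousLinearMap.fst ℝ E ℝ) +
    (ContinuousLinearMap.mul ℝ ℝ).bilinearComp (ContinuousLinearMap.snd ℝ E ℝ)
      (ContinuousLinearMap.snd ℝ E ℝ)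

theorem prodPairing_apply {E : Type*} [NormedAddCommGroup E] [InnerProductSpace ℝ E]
    (v w : E × ℝ) :
    prodPairing E v w = inner ℝ v.1 w.1 + v.2 * w.2 := rfl

section Extension

variable {E : Type*} [NormedAddCommGroup E] [InnerProductSpace ℝ E] [FiniteDimensional ℝ E]
  [MeasurableSpace E] [BorelSpace E]

theorem integrable_of_norm_le_pow_mul (F : 𝓢(E, ℂ)) {w : E → ℂ} (hw : Continuous w) {C : ℝ} {j : ℕ}
    (hwF : ∀ ξ, ‖w ξ‖ ≤ C * (‖ξ‖ ^ j * ‖F ξ‖)) : Integrable w :=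
  ((F.integrable_pow_mul volume j).const_mul C).mono' hw.aestronglyMeasurable (ae_of_all _ hwF)

theorem memLp_two_of_norm_le_pow_mul (F : 𝓢(E, ℂ)) {w : E → ℂ} (hw : Continuous w) {C : ℝ} {j : ℕ}
    (hwF : ∀ ξ, ‖w ξ‖ ≤ C * (‖ξ‖ ^ j * ‖F ξ‖)) : MemLp w 2 := by
  obtain ⟨D, hD, hDF⟩ := F.decay j 0
  simp only [norm_iteratedFDeriv_zero] at hDF
  rw [memLp_two_iff_integrable_sq_norm hw.aestronglyMeasurable]
  refine ((integrable_of_norm_le_pow_mul F hw hwF).norm.const_mul (|C| * D)).mono'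
    (hw.norm.pow 2).aestronglyMeasurable (ae_of_all _ fun ξ => ?_)
  rw [Real.norm_of_nonneg (by positivity), sq]
  gcongr
  calc ‖w ξ‖ ≤ C * (‖ξ‖ ^ j * ‖F ξ‖) := hwF ξ
    _ ≤ |C| * (‖ξ‖ ^ j * ‖F ξ‖) := by gcongr; exact le_abs_self C
    _ ≤ |C| * D := by gcongr; exact hDF ξ

/-- The function on `E × ℝ` whose partial Fourier transform at `(ξ, t)` is `F ξ φ(2π |ξ| t)`. -/
noncomputable def extension (F : 𝓢(E, ℂ)) (φ : ℝ → ℝ) (X : E × ℝ) : ℂ :=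
  𝓕 (symbolMul F φ X.2) X.1

/-- Writing `φ` as the characteristic function of `ν` exhibits the extension as a Fourier integral
on `E × ℝ` against the image of `dξ ⊗ ν`, with density `F`. All moments are finite, so it is smooth
jointly in `(x, t)`. -/
theorem contDiff_extension [SecondCountableTopology E] (F : 𝓢(E, ℂ)) {φ : ℝ → ℝ} {ν : Measure ℝ}
    [IsFiniteMeasure ν] (hν : ∀ k : ℕ, Integrable (fun τ => |τ| ^ k) ν)
    (hφ : ∀ t : ℝ, ∫ τ, Complex.exp (t * τ * Complex.I) ∂ν = (φ t : ℂ)) :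
    ContDiff ℝ ∞ (extension F φ) := by
  -- The sign turns the kernel `e^(-2πi⟨·,·⟩)` into `e^(i (2π‖ξ‖t) τ)` in the last variable, whose
  -- `ν`-integral is `φ(2π‖ξ‖t)`.
  set T : E × ℝ → E × ℝ := fun p => (p.1, -(‖p.1‖ * p.2)) with hT
  have hTm : Measurable T := by fun_prop
  set μ := ((volume : Measure E).prod ν).map T with hμ
  have hmom : ∀ k : ℕ, Integrable (fun v : E × ℝ => ‖v‖ ^ k * ‖F v.1‖) μ := by
    intro k
    rw [hμ, integrable_map_measure (Continuous.aestronglyMeasurable (by fun_prop)) hTm.aemeasurable]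
    have h1 : Integrable (fun τ => 2 ^ (k - 1) * (1 ^ k + |τ| ^ k)) ν :=
      ((integrable_const _).add (hν k)).const_mul _
    refine ((F.integrable_pow_mul volume k).mul_prod h1).mono'
      (Measurable.aestronglyMeasurable (by fun_prop)) (ae_of_all _ fun p => ?_)
    simp only [Function.comp, hT]
    rw [norm_mul, norm_norm, norm_pow, norm_norm, Prod.norm_def, norm_neg, norm_mul, norm_norm,
      Real.norm_eq_abs]
    -- This bound separates the variables: Schwartz decay handles `ξ`, the moments of `ν` handle
    -- `τ`.
    have h2 : max ‖p.1‖ (‖p.1‖ * |p.2|) ≤ ‖p.1‖ * (1 + |p.2|) := by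
      refine max_le ?_ ?_ <;> nlinarith [norm_nonneg p.1, abs_nonneg p.2,
        mul_nonneg (norm_nonneg p.1) (abs_nonneg p.2)]
    calc (max ‖p.1‖ (‖p.1‖ * |p.2|)) ^ k * ‖F p.1‖
        ≤ (‖p.1‖ * (1 + |p.2|)) ^ k * ‖F p.1‖ := by gcongr
      _ = ‖p.1‖ ^ k * ‖F p.1‖ * (1 + |p.2|) ^ k := by rw [mul_pow]; ring
      _ ≤ _ := by
        gcongr
        exact add_pow_le zero_le_one (abs_nonneg _) k
  have key := VectorFourier.contDiff_fourierIntegral (N := (⊤ : ℕ∞)) (μ := μ) (prodPairing E)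
    (f := fun v : E × ℝ => F v.1) (fun k _ => hmom k)
  convert! key using 1
  funext X
  obtain ⟨x, t⟩ := X
  have hint : Integrable (fun p : E × ℝ =>
      Real.fourierChar (-(prodPairing E (T p) (x, t))) • F p.1) ((volume : Measure E).prod ν) := by
    have h0 : Integrable (fun p : E × ℝ => ‖F p.1‖) ((volume : Measure E).prod ν) := by
      have := (F.integrable (μ := volume)).norm.mul_prod (integrable_const (μ := ν) (1 : ℝ))
      simpa using this
    refine h0.mono' (Measurable.aestronglyMeasurable ?_) (ae_of_all _ fun p => ?_)
    · simp only [prodPairing_apply, hT]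
      have : Continuous fun p : E × ℝ => Real.fourierChar (-(inner ℝ p.1 x + -(‖p.1‖ * p.2) * t))
          • F p.1 :=
        (Real.continuous_fourierChar.comp (by fun_prop)).smul (by fun_prop)
      exact this.measurable
    · rw [Circle.norm_smul]
  rw [extension, VectorFourier.fourierIntegral, hμ, integral_map hTm.aemeasurable, Real.fourier_eq]
  · have hL : ∀ v w, (prodPairing E).toLinearMap₁₂ v w = prodPairing E v w := fun _ _ => rfl
    simp only [hL]
    have : ∀ p : E × ℝ, (T p).1 = p.1 := fun p => rfl
    simp only [this]
    rw [integral_prod _ hint]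
    refine integral_congr_ae (ae_of_all _ fun ξ => ?_)
    simp only [symbolMul]
    rw [← hφ, ← integral_const_mul, Circle.smul_def, smul_eq_mul, ← integral_const_mul]
    refine integral_congr_ae (ae_of_all _ fun τ => ?_)
    simp only [prodPairing_apply, hT, Circle.smul_def, Real.fourierChar_apply, smul_eq_mul]
    rw [mul_comm (F ξ), ← mul_assoc, ← Complex.exp_add]
    congr 2
    push_cast
    ring
  · refine Continuous.aestronglyMeasurable ?_
    refine (Real.continuous_fourierChar.comp ?_).smul (by fun_prop)
    exact ((prodPairing E).continuous.clm_apply continuous_const).neg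

variable {F : 𝓢(E, ℂ)} {φ φ' : ℝ → ℝ} {C : ℝ}

theorem lintegral_extension_sq_le (hφ : Continuous φ) (hC : ∀ t, |φ t| ≤ C) (t : ℝ) :
    ∫⁻ x, ‖extension F φ (x, t)‖ₑ ^ 2 ≤ ENNReal.ofReal (C ^ 2) * ∫⁻ ξ, ‖F ξ‖ₑ ^ 2 := by
  have hC0 : 0 ≤ C := (abs_nonneg _).trans (hC 0)
  simp only [extension]
  rw [lintegral_enorm_fourier_sq
    (integrable_of_norm_le_pow_mul F (continuous_symbolMul hφ t) (norm_symbolMul_le hC t))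
    (memLp_two_of_norm_le_pow_mul F (continuous_symbolMul hφ t) (norm_symbolMul_le hC t)),
    ← lintegral_const_mul' _ _ ENNReal.ofReal_ne_top]
  refine lintegral_mono fun ξ => ?_
  have h := norm_symbolMul_le (F := F) hC t ξ
  rw [pow_zero, one_mul] at h
  rw [← ofReal_norm, ← ofReal_norm, ← ENNReal.ofReal_pow (norm_nonneg _),
    ← ENNReal.ofReal_pow (norm_nonneg _), ← ENNReal.ofReal_mul (by positivity), ← mul_pow]
  gcongr

theorem lintegral_fderiv_extension_slice_sq (hφ : Continuous φ) (hC : ∀ t, |φ t| ≤ C) (t : ℝ)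
    (v : E) :
    ∫⁻ x, ‖fderiv ℝ (fun x => extension F φ (x, t)) x v‖ₑ ^ 2 =
      ∫⁻ ξ, ENNReal.ofReal ((2 * Real.pi * inner ℝ ξ v) ^ 2) * ‖symbolMul F φ t ξ‖ₑ ^ 2 := by
  have hc := continuous_symbolMul (F := F) hφ t
  have hi := integrable_of_norm_le_pow_mul F hc (norm_symbolMul_le hC t)
  have hi2 : Integrable fun ξ => ‖ξ‖ * ‖symbolMul F φ t ξ‖ := by
    have h := integrable_of_norm_le_pow_mul F (w := fun ξ => ((1 * ‖ξ‖ : ℝ) : ℂ) * symbolMul F φ t ξ)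
      (by fun_prop) (norm_norm_mul_symbolMul_le hC 1 t)
    refine h.norm.congr (ae_of_all _ fun ξ => ?_)
    simp
  have hfi : Integrable (VectorFourier.fourierSMulRight (innerSL ℝ) (symbolMul F φ t)) := by
    refine (hi2.const_mul (2 * Real.pi * ‖(innerSL ℝ : E →L[ℝ] E →L[ℝ] ℝ)‖)).mono'
      hi.1.fourierSMulRight (ae_of_all _ fun ξ => ?_)
    refine (VectorFourier.norm_fourierSMulRight_le _ _ _).trans_eq (by ring)
  have e : ∀ x, fderiv ℝ (fun x => extension F φ (x, t)) x v =
      𝓕 (fun ξ => VectorFourier.fourierSMulRight (innerSL ℝ) (symbolMul F φ t) ξ v) x := fun x => by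
    have h := Real.fderiv_fourier hi hi2
    simp only [extension]
    change fderiv ℝ (𝓕 (symbolMul F φ t)) x v = _
    rw [h]
    exact Real.fourier_continuousLinearMap_apply hfi
  have ew : ∀ ξ, VectorFourier.fourierSMulRight (innerSL ℝ) (symbolMul F φ t) ξ v =
      -(2 * (Real.pi : ℂ) * Complex.I) • ((inner ℝ ξ v : ℝ) • symbolMul F φ t ξ) := fun ξ => rfl
  simp only [e, ew]
  have hwc : Continuous fun ξ =>
      -(2 * (Real.pi : ℂ) * Complex.I) • ((inner ℝ ξ v : ℝ) • symbolMul F φ t ξ) := by fun_prop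
  have hwF : ∀ ξ, ‖-(2 * (Real.pi : ℂ) * Complex.I) • ((inner ℝ ξ v : ℝ) • symbolMul F φ t ξ)‖ ≤
      (2 * Real.pi * ‖v‖ * C) * (‖ξ‖ ^ 1 * ‖F ξ‖) := fun ξ => by
    have h1 := norm_symbolMul_le (F := F) hC t ξ
    have h2 := abs_real_inner_le_norm ξ v
    rw [norm_smul, norm_smul, norm_neg, Real.norm_eq_abs]
    have h3 : ‖2 * (Real.pi : ℂ) * Complex.I‖ = 2 * Real.pi := by simp [abs_of_pos Real.pi_pos]
    rw [h3]
    calc 2 * Real.pi * (|inner ℝ ξ v| * ‖symbolMul F φ t ξ‖)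
        ≤ 2 * Real.pi * ((‖ξ‖ * ‖v‖) * (C * (‖ξ‖ ^ 0 * ‖F ξ‖))) := by gcongr
      _ = _ := by ring
  rw [lintegral_enorm_fourier_sq (integrable_of_norm_le_pow_mul F hwc hwF)
    (memLp_two_of_norm_le_pow_mul F hwc hwF)]
  refine lintegral_congr fun ξ => ?_
  rw [← ofReal_norm, ← ofReal_norm, ← ENNReal.ofReal_pow (norm_nonneg _),
    ← ENNReal.ofReal_pow (norm_nonneg _), ← ENNReal.ofReal_mul (by positivity), norm_smul, norm_smul]
  congr 1
  simp only [norm_neg, norm_mul, Complex.norm_I, Complex.norm_real, Complex.norm_ofNat,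
    Real.norm_eq_abs, mul_pow, sq_abs]
  ring

theorem hasDerivAt_extension_slice (hφ : ∀ t, HasDerivAt φ (φ' t) t) (hφ'c : Continuous φ')
    (hC : ∀ t, |φ t| ≤ C) (hC' : ∀ t, |φ' t| ≤ C) (x : E) (t : ℝ) :
    HasDerivAt (fun t => extension F φ (x, t))
      (𝓕 (fun ξ => ((2 * Real.pi * ‖ξ‖ : ℝ) : ℂ) * symbolMul F φ' t ξ) x) t := by
  have hφc : Continuous φ := continuous_iff_continuousAt.2 fun t => (hφ t).continuousAt
  simp only [extension, Real.fourier_eq']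
  have hn : ∀ (ξ : E) (z : ℂ),
      ‖Complex.exp ((↑(-2 * Real.pi * inner ℝ ξ x) : ℂ) * Complex.I) • z‖ = ‖z‖ := fun x z => by
    rw [norm_smul, Complex.norm_exp_ofReal_mul_I, one_mul]
  refine (hasDerivAt_integral_of_dominated_loc_of_deriv_le (μ := (volume : Measure E))
    (F := fun t ξ => Complex.exp ((↑(-2 * Real.pi * inner ℝ ξ x) : ℂ) * Complex.I) •
      symbolMul F φ t ξ)
    (F' := fun t ξ => Complex.exp ((↑(-2 * Real.pi * inner ℝ ξ x) : ℂ) * Complex.I) •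
      (((2 * Real.pi * ‖ξ‖ : ℝ) : ℂ) * symbolMul F φ' t ξ))
    (bound := fun ξ => (|2 * Real.pi| * C) * (‖ξ‖ ^ 1 * ‖F ξ‖))
    (s := univ) Filter.univ_mem (Filter.Eventually.of_forall fun t => ?_) ?_ ?_
    (ae_of_all _ fun ξ t _ => ?_) ((F.integrable_pow_mul volume 1).const_mul _)
    (ae_of_all _ fun ξ t _ => ?_)).2
  · have := continuous_symbolMul (F := F) hφc t
    exact Continuous.aestronglyMeasurable (by fun_prop)
  · have := continuous_symbolMul (F := F) hφc t
    refine (integrable_of_norm_le_pow_mul F this (norm_symbolMul_le hC t)).norm.mono'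
      (Continuous.aestronglyMeasurable (by fun_prop)) (ae_of_all _ fun ξ => ?_)
    rw [hn]
  · have := continuous_symbolMul (F := F) hφ'c t
    exact Continuous.aestronglyMeasurable (by fun_prop)
  · rw [hn]
    exact norm_norm_mul_symbolMul_le hC' _ t ξ
  · have h1 : HasDerivAt (fun t => 2 * Real.pi * ‖ξ‖ * t) (2 * Real.pi * ‖ξ‖) t := by
      simpa using (hasDerivAt_id t).const_mul (2 * Real.pi * ‖ξ‖)
    have h2 := ((hφ (2 * Real.pi * ‖ξ‖ * t)).comp t h1).ofReal_comp
    refine ((h2.const_mul (F ξ)).const_mul _).congr_deriv ?_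
    simp only [symbolMul, smul_eq_mul]
    push_cast
    ring

theorem lintegral_deriv_extension_slice_sq (hφ'c : Continuous φ')
    (hC' : ∀ t, |φ' t| ≤ C) (t : ℝ) :
    ∫⁻ x : E, ‖𝓕 (fun ξ => ((2 * Real.pi * ‖ξ‖ : ℝ) : ℂ) * symbolMul F φ' t ξ) x‖ₑ ^ 2 =
      ∫⁻ ξ, ENNReal.ofReal ((2 * Real.pi * ‖ξ‖) ^ 2) * ‖symbolMul F φ' t ξ‖ₑ ^ 2 := by
  have hc := continuous_symbolMul (F := F) hφ'c t
  rw [lintegral_enorm_fourier_sq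
    (integrable_of_norm_le_pow_mul F (by fun_prop) (norm_norm_mul_symbolMul_le hC' _ t))
    (memLp_two_of_norm_le_pow_mul F (by fun_prop) (norm_norm_mul_symbolMul_le hC' _ t))]
  refine lintegral_congr fun ξ => ?_
  rw [enorm_mul, mul_pow]
  congr 1
  rw [← ofReal_norm, ← ENNReal.ofReal_pow (norm_nonneg _), Complex.norm_real, Real.norm_eq_abs,
    sq_abs]

end Extension

end FracCapacity

/-! ### Weighted energy of the extension. -/

namespace FracCapacity

open MeasureTheory Set FourierTransform SchwartzMap

theorem fderiv_re_apply {V : Type*} [NormedAddCommGroup V] [NormedSpace ℝ V] {U : V → ℂ} {X : V}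
    (hU : DifferentiableAt ℝ U X) (v : V) :
    fderiv ℝ (fun X => (U X).re) X v = (fderiv ℝ U X v).re := by
  have h : HasFDerivAt (fun X => (U X).re) (Complex.reCLM.comp (fderiv ℝ U X)) X :=
    Complex.reCLM.hasFDerivAt.comp X hU.hasFDerivAt
  rw [h.fderiv]
  rfl

theorem enorm_re_le (z : ℂ) : ‖z.re‖ₑ ≤ ‖z‖ₑ := by
  rw [← ofReal_norm, ← ofReal_norm]
  exact ENNReal.ofReal_le_ofReal (Complex.abs_re_le_norm z)

/-- Taking real parts does not increase the energy. By Plancherel the frequency `ξ` contributes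
`k²|F ξ|²` times the energy of `t ↦ φ(kt)` with `k = 2π‖ξ‖`, and dilation turns this into at most
`k^(2σ)|F ξ|² M`. -/
theorem weightedEnergy_re_extension_le {n : ℕ} {σ : ℝ}
    {F : 𝓢(EuclideanSpace ℝ (Fin n), ℂ)} {φ φ' : ℝ → ℝ} {C : ℝ} {M : ℝ≥0∞}
    (hU : ContDiff ℝ ∞ (extension F φ))
    (hφ : ∀ t, HasDerivAt φ (φ' t) t) (hφ'c : Continuous φ')
    (hC : ∀ t, |φ t| ≤ C) (hC' : ∀ t, |φ' t| ≤ C)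
    (hM : ∫⁻ t, ENNReal.ofReal (|t| ^ (1 - 2 * σ)) * (‖φ t‖ₑ ^ 2 + ‖φ' t‖ₑ ^ 2) ≤ M) :
    weightedEnergy σ (fun X => (extension F φ X).re) ≤
      M * ∫⁻ ξ, ENNReal.ofReal ((2 * Real.pi * ‖ξ‖) ^ (2 * σ)) * ‖F ξ‖ₑ ^ 2 := by
  have hφc : Continuous φ := continuous_iff_continuousAt.2 fun t => (hφ t).continuousAt
  have hU1 : ContDiff ℝ 1 (extension F φ) := hU.of_le (by norm_cast)
  have hUd := hU1.differentiable one_ne_zero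
  have hre : ContDiff ℝ 1 (fun X => (extension F φ X).re) := Complex.reCLM.contDiff.comp hU1
  have hkF : Continuous fun ξ => F ξ := F.continuous
  have hsl : ∀ t, ((∑ i, ∫⁻ x, ‖fderiv ℝ (fun X => (extension F φ X).re) (x, t)
        (EuclideanSpace.single i 1, 0)‖ₑ ^ 2)
        + ∫⁻ x, ‖fderiv ℝ (fun X => (extension F φ X).re) (x, t) (0, 1)‖ₑ ^ 2) ≤
      ∫⁻ ξ, ENNReal.ofReal ((2 * Real.pi * ‖ξ‖) ^ 2) * ‖F ξ‖ₑ ^ 2 *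
        (‖φ (2 * Real.pi * ‖ξ‖ * t)‖ₑ ^ 2 + ‖φ' (2 * Real.pi * ‖ξ‖ * t)‖ₑ ^ 2) := by
    intro t
    have e1 : ∀ i : Fin n, ∫⁻ x, ‖fderiv ℝ (fun X => (extension F φ X).re) (x, t)
        (EuclideanSpace.single i 1, 0)‖ₑ ^ 2 ≤
        ∫⁻ ξ, ENNReal.ofReal ((2 * Real.pi * inner ℝ ξ (EuclideanSpace.single i 1)) ^ 2) *
          ‖symbolMul F φ t ξ‖ₑ ^ 2 := fun i => by
      rw [← lintegral_fderiv_extension_slice_sq hφc hC]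
      gcongr with x
      rw [fderiv_re_apply (hUd _), ← fderiv_slice_apply (hUd _)]
      exact enorm_re_le _
    have e2 : ∫⁻ x, ‖fderiv ℝ (fun X => (extension F φ X).re) (x, t) (0, 1)‖ₑ ^ 2 ≤
        ∫⁻ ξ, ENNReal.ofReal ((2 * Real.pi * ‖ξ‖) ^ 2) * ‖symbolMul F φ' t ξ‖ₑ ^ 2 := by
      rw [← lintegral_deriv_extension_slice_sq hφ'c hC']
      gcongr with x
      rw [fderiv_re_apply (hUd _), (hasDerivAt_slice (hUd _)).unique
        (hasDerivAt_extension_slice hφ hφ'c hC hC' x t)]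
      exact enorm_re_le _
    refine (add_le_add (Finset.sum_le_sum fun i _ => e1 i) e2).trans_eq ?_
    have m1 : Measurable fun ξ => ‖symbolMul F φ t ξ‖ₑ ^ 2 :=
      (continuous_symbolMul hφc t).measurable.enorm.pow_const 2
    rw [sum_lintegral_ofReal_inner_single_sq_mul m1, ← lintegral_add_left (by fun_prop)]
    refine lintegral_congr fun ξ => ?_
    have h3 : ∀ r : ℝ, ‖(r : ℂ)‖ₑ = ‖r‖ₑ := fun r => by
      rw [← ofReal_norm, ← ofReal_norm, Complex.norm_real]
    rw [symbolMul, symbolMul, enorm_mul, enorm_mul, h3, h3]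
    ring
  have hmeas : Measurable fun p : ℝ × EuclideanSpace ℝ (Fin n) =>
      ENNReal.ofReal (|p.1| ^ (1 - 2 * σ)) *
      (ENNReal.ofReal ((2 * Real.pi * ‖p.2‖) ^ 2) * ‖F p.2‖ₑ ^ 2 *
        (‖φ (2 * Real.pi * ‖p.2‖ * p.1)‖ₑ ^ 2 + ‖φ' (2 * Real.pi * ‖p.2‖ * p.1)‖ₑ ^ 2)) := by
    have h1 : Measurable fun p : ℝ × EuclideanSpace ℝ (Fin n) => ‖F p.2‖ₑ ^ 2 :=
      (hkF.measurable.comp measurable_snd).enorm.pow_const 2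
    have h2 : ∀ ψ : ℝ → ℝ, Continuous ψ → Measurable fun p : ℝ × EuclideanSpace ℝ (Fin n) =>
        ‖ψ (2 * Real.pi * ‖p.2‖ * p.1)‖ₑ ^ 2 := fun ψ hψ =>
      (hψ.measurable.comp (by fun_prop)).enorm.pow_const 2
    exact Measurable.mul (by fun_prop) (((Measurable.mul (by fun_prop) h1)).mul
      ((h2 φ hφc).add (h2 φ' hφ'c)))
  rw [weightedEnergy_eq σ hre]
  calc _ ≤ ∫⁻ t, ∫⁻ ξ, ENNReal.ofReal (|t| ^ (1 - 2 * σ)) *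
        (ENNReal.ofReal ((2 * Real.pi * ‖ξ‖) ^ 2) * ‖F ξ‖ₑ ^ 2 *
        (‖φ (2 * Real.pi * ‖ξ‖ * t)‖ₑ ^ 2 + ‖φ' (2 * Real.pi * ‖ξ‖ * t)‖ₑ ^ 2)) := by
        refine lintegral_mono fun t => ?_
        rw [lintegral_const_mul' _ _ ENNReal.ofReal_ne_top]
        exact mul_le_mul_right (hsl t) _
    _ = ∫⁻ ξ, ∫⁻ t, ENNReal.ofReal (|t| ^ (1 - 2 * σ)) *
        (ENNReal.ofReal ((2 * Real.pi * ‖ξ‖) ^ 2) * ‖F ξ‖ₑ ^ 2 *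
        (‖φ (2 * Real.pi * ‖ξ‖ * t)‖ₑ ^ 2 + ‖φ' (2 * Real.pi * ‖ξ‖ * t)‖ₑ ^ 2)) :=
        lintegral_lintegral_swap hmeas.aemeasurable
    _ ≤ ∫⁻ ξ, M * (ENNReal.ofReal ((2 * Real.pi * ‖ξ‖) ^ (2 * σ)) * ‖F ξ‖ₑ ^ 2) := by
        refine lintegral_mono fun ξ => ?_
        have hk : 0 ≤ 2 * Real.pi * ‖ξ‖ := by positivity
        generalize 2 * Real.pi * ‖ξ‖ = k at hk
        rcases eq_or_lt_of_le hk with rfl | hk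
        · simp
        have hne : ENNReal.ofReal (k ^ 2) * ‖F ξ‖ₑ ^ 2 ≠ ⊤ :=
          ENNReal.mul_ne_top ENNReal.ofReal_ne_top (ENNReal.pow_ne_top enorm_ne_top)
        have e : ∀ t, ENNReal.ofReal (|t| ^ (1 - 2 * σ)) *
            (ENNReal.ofReal (k ^ 2) * ‖F ξ‖ₑ ^ 2 * (‖φ (k * t)‖ₑ ^ 2 + ‖φ' (k * t)‖ₑ ^ 2)) =
            (ENNReal.ofReal (k ^ 2) * ‖F ξ‖ₑ ^ 2) * (ENNReal.ofReal (|t| ^ (1 - 2 * σ)) *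
              (‖φ (k * t)‖ₑ ^ 2 + ‖φ' (k * t)‖ₑ ^ 2)) := fun t => by ring
        simp only [e]
        rw [lintegral_const_mul' _ _ hne,
          lintegral_abs_rpow_comp_mul (1 - 2 * σ) (fun t => ‖φ t‖ₑ ^ 2 + ‖φ' t‖ₑ ^ 2) hk]
        have hk2 : ENNReal.ofReal (k ^ 2) * ENNReal.ofReal (k ^ (-1 - (1 - 2 * σ))) =
            ENNReal.ofReal (k ^ (2 * σ)) := by
          rw [← ENNReal.ofReal_mul (by positivity), ← Real.rpow_natCast, ← Real.rpow_add hk]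
          congr 2; push_cast; ring
        calc _ = (ENNReal.ofReal (k ^ 2) * ENNReal.ofReal (k ^ (-1 - (1 - 2 * σ)))) * ‖F ξ‖ₑ ^ 2 *
              ∫⁻ t, ENNReal.ofReal (|t| ^ (1 - 2 * σ)) * (‖φ t‖ₑ ^ 2 + ‖φ' t‖ₑ ^ 2) := by ring
          _ ≤ ENNReal.ofReal (k ^ (2 * σ)) * ‖F ξ‖ₑ ^ 2 * M := by rw [hk2]; gcongr
          _ = _ := by ring
    _ = _ := by
        have : Measurable fun ξ => ‖F ξ‖ₑ ^ 2 := hkF.measurable.enorm.pow_const 2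
        exact lintegral_const_mul _ (Measurable.mul (by fun_prop) this)

end FracCapacity

/-! ### Cutoff to compact support. -/

namespace FracCapacity

open MeasureTheory Set Filter Topology

/-- Young's inequality, weighted so that the main term keeps a constant close to `1` and the cutoff
error takes the large one. -/
theorem enorm_add_sq_le_mul_add_mul {δ : ℝ} (hδ : 0 < δ) (a b : ℝ) :
    ‖a + b‖ₑ ^ 2 ≤
      ENNReal.ofReal (1 + δ) * ‖a‖ₑ ^ 2 + ENNReal.ofReal (1 + δ⁻¹) * ‖b‖ₑ ^ 2 := by
  have h : ∀ r : ℝ, ‖r‖ₑ ^ 2 = ENNReal.ofReal (r ^ 2) := fun r => by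
    rw [← ofReal_norm, ← ENNReal.ofReal_pow (norm_nonneg _), Real.norm_eq_abs, sq_abs]
  rw [h, h, h, ← ENNReal.ofReal_mul (by positivity), ← ENNReal.ofReal_mul (by positivity),
    ← ENNReal.ofReal_add (by positivity) (by positivity)]
  refine ENNReal.ofReal_le_ofReal ?_
  have h1 : (1 + δ) * a ^ 2 + (1 + δ⁻¹) * b ^ 2 - (a + b) ^ 2 = δ⁻¹ * (δ * a - b) ^ 2 := by
    field_simp; ring
  have h2 : 0 ≤ δ⁻¹ * (δ * a - b) ^ 2 := by positivity
  linarith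

/-- Smooth cutoff functions at scale `R`, with gradient of size `1 / R`. -/
theorem exists_cutoff (V : Type*) [NormedAddCommGroup V] [NormedSpace ℝ V]
    [FiniteDimensional ℝ V] [HasContDiffBump V] :
    ∃ (χ : ℝ → V → ℝ) (D : ℝ), ∀ R, 0 < R → ContDiff ℝ ∞ (χ R) ∧ HasCompactSupport (χ R) ∧
      (∀ X, |χ R X| ≤ 1) ∧ (∀ X, ‖X‖ ≤ R → χ R X = 1) ∧
      (∀ X v, ‖v‖ ≤ 1 → |fderiv ℝ (χ R) X v| ≤ D * R⁻¹) ∧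
      (∀ X, 2 * R < ‖X‖ → fderiv ℝ (χ R) X = 0) := by
  let b : ContDiffBump (0 : V) := ⟨1, 2, one_pos, one_lt_two⟩
  have hb1 : ContDiff ℝ 1 b := b.contDiff
  obtain ⟨D, hD⟩ := (b.hasCompactSupport.fderiv ℝ).exists_bound_of_continuous
    (hb1.continuous_fderiv one_ne_zero)
  refine ⟨fun R X => b (R⁻¹ • X), D, fun R hR => ?_⟩
  have hf : ∀ X, fderiv ℝ (fun X => b (R⁻¹ • X)) X = R⁻¹ • fderiv ℝ b (R⁻¹ • X) := fun X => by
    exact fderiv_comp_smul (f := b) R⁻¹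
  have hn : ∀ X : V, ‖R⁻¹ • X‖ = R⁻¹ * ‖X‖ := fun X => by
    rw [norm_smul, Real.norm_of_nonneg (by positivity)]
  have hD0 : 0 ≤ D := (norm_nonneg _).trans (hD 0)
  refine ⟨b.contDiff.comp (by fun_prop), b.hasCompactSupport.comp_homeomorph
    (Homeomorph.smulOfNeZero R⁻¹ (by positivity)), fun X => ?_, fun X hX => ?_, fun X v hv => ?_,
    fun X hX => ?_⟩
  · rw [abs_of_nonneg b.nonneg]; exact b.le_one
  · refine b.one_of_mem_closedBall ?_
    rw [mem_closedBall_zero_iff, hn]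
    rw [inv_mul_le_iff₀ hR]; simpa [b] using hX
  · rw [hf, ← Real.norm_eq_abs]
    refine (ContinuousLinearMap.le_opNorm _ _).trans ?_
    rw [norm_smul, Real.norm_of_nonneg (by positivity : 0 ≤ R⁻¹), mul_comm D]
    calc R⁻¹ * ‖fderiv ℝ b (R⁻¹ • X)‖ * ‖v‖ ≤ R⁻¹ * D * 1 := by gcongr; exact hD _
      _ = _ := mul_one _
  · rw [hf]
    have : R⁻¹ • X ∉ tsupport b := by
      rw [b.tsupport_eq, mem_closedBall_zero_iff, hn, not_le]
      change 2 < _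
      rw [lt_inv_mul_iff₀ hR]; linarith
    rw [image_eq_zero_of_notMem_tsupport fun h => this (tsupport_fderiv_subset ℝ h), smul_zero]

theorem lintegral_abs_rpow_indicator_lt_top {a : ℝ} (ha : -1 < a) :
    ∫⁻ t : ℝ, ENNReal.ofReal (|t| ^ a) * (Icc (-2 : ℝ) 2).indicator 1 t < ⊤ := by
  have h := (intervalIntegrable_abs_rpow_mul ha (h := fun _ => 1) continuous_const (-2) 2)
  rw [intervalIntegrable_iff_integrableOn_Icc_of_le (by norm_num)] at h
  have h2 := h.2
  rw [hasFiniteIntegral_iff_enorm, ← lintegral_indicator measurableSet_Icc] at h2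
  refine lt_of_eq_of_lt (lintegral_congr fun t => ?_) h2
  by_cases ht : t ∈ Icc (-2 : ℝ) 2
  · rw [indicator_of_mem ht, indicator_of_mem ht, Pi.one_apply, mul_one, mul_one,
      Real.enorm_eq_ofReal (by positivity)]
  · rw [indicator_of_notMem ht, indicator_of_notMem ht, mul_zero]

theorem norm_single_zero_le {n : ℕ} (i : Fin n) :
    ‖((EuclideanSpace.single i 1, 0) : EuclideanSpace ℝ (Fin n) × ℝ)‖ ≤ 1 := by
  simp [Prod.norm_def]

/-- Cutting off a function of finite energy with uniformly square integrable slices. -/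
theorem exists_compactSupport_weightedEnergy_le {n : ℕ} {σ : ℝ} (hσ0 : 0 < σ) (hσ1 : σ < 1)
    {G : EuclideanSpace ℝ (Fin n) × ℝ → ℝ} (hG : ContDiff ℝ ∞ G) {B : ℝ≥0∞} (hB : B ≠ ⊤)
    (hGB : ∀ t, ∫⁻ x, ‖G (x, t)‖ₑ ^ 2 ≤ B) {Λ : Set (EuclideanSpace ℝ (Fin n))}
    (hΛ : Bornology.IsBounded Λ) {δ : ℝ} (hδ : 0 < δ) :
    ∃ H : EuclideanSpace ℝ (Fin n) × ℝ → ℝ, ContDiff ℝ ∞ H ∧ HasCompactSupport H ∧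
      (∀ x ∈ Λ, H (x, 0) = G (x, 0)) ∧
      weightedEnergy σ H ≤ ENNReal.ofReal (1 + δ) * weightedEnergy σ G + ENNReal.ofReal δ := by
  obtain ⟨χ, D, hχ⟩ := exists_cutoff (EuclideanSpace ℝ (Fin n) × ℝ)
  have hG1 : ContDiff ℝ 1 G := hG.of_le (by norm_cast)
  set J : ℝ → ℝ≥0∞ := (Icc (-2 : ℝ) 2).indicator 1 with hJ
  have hJm : Measurable J := measurable_one.indicator measurableSet_Icc
  set I : ℝ≥0∞ := ∫⁻ t : ℝ, ENNReal.ofReal (|t| ^ (1 - 2 * σ)) * J t with hI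
  have hIt : I ≠ ⊤ := (lintegral_abs_rpow_indicator_lt_top (by linarith)).ne
  set K : ℝ≥0∞ := (n + 1) * (ENNReal.ofReal (1 + δ⁻¹) * ENNReal.ofReal (D ^ 2) * B) * I with hK
  have hKt : K ≠ ⊤ := by
    refine ENNReal.mul_ne_top (ENNReal.mul_ne_top ?_ (ENNReal.mul_ne_top (ENNReal.mul_ne_top
      ENNReal.ofReal_ne_top ENNReal.ofReal_ne_top) hB)) hIt
    exact ENNReal.add_ne_top.2 ⟨ENNReal.natCast_ne_top n, ENNReal.one_ne_top⟩
  -- The gradient of the cutoff is at most `D/R` and vanishes for `|t| > 2R`; in `x` the slice bound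
  -- `B` suffices. The error is thus `R⁻²` times `∫_{|t| ≤ 2R} |t|^(1-2σ) dt`, a multiple of
  -- `R^(-2σ)`. The factor `n + 1` in `K` counts the directions.
  have hscale : ∀ R, 0 < R → weightedEnergy σ (fun X => χ R X * G X) ≤
      ENNReal.ofReal (1 + δ) * weightedEnergy σ G + K * ENNReal.ofReal (R ^ (-(2 * σ))) := by
    intro R hR
    obtain ⟨hχd, hχs, hχ1, hχe, hχg, hχz⟩ := hχ R hR
    have hχd1 : ContDiff ℝ 1 (χ R) := hχd.of_le (by norm_cast)
    set P : ℝ≥0∞ := ENNReal.ofReal (1 + δ⁻¹) * ENNReal.ofReal (D ^ 2) * B with hP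
    have hdir : ∀ v, ‖v‖ ≤ 1 → ∀ t,
        ∫⁻ x, ‖fderiv ℝ (fun X => χ R X * G X) (x, t) v‖ₑ ^ 2 ≤
        ENNReal.ofReal (1 + δ) * (∫⁻ x, ‖fderiv ℝ G (x, t) v‖ₑ ^ 2) +
          P * (ENNReal.ofReal (R⁻¹ ^ 2) * J (R⁻¹ * t)) := by
      intro v hv t
      have hcd : Continuous fun x => fderiv ℝ G (x, t) v :=
        ((hG1.continuous_fderiv one_ne_zero).clm_apply continuous_const).comp (by fun_prop)
      have hcG : Continuous fun x => G (x, t) := hG.continuous.comp (by fun_prop)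
      have hpt : ∀ x, ‖fderiv ℝ (fun X => χ R X * G X) (x, t) v‖ₑ ^ 2 ≤
          ENNReal.ofReal (1 + δ) * ‖fderiv ℝ G (x, t) v‖ₑ ^ 2 +
          (ENNReal.ofReal (1 + δ⁻¹) * ENNReal.ofReal (D ^ 2) *
            (ENNReal.ofReal (R⁻¹ ^ 2) * J (R⁻¹ * t))) * ‖G (x, t)‖ₑ ^ 2 := by
        intro x
        have hfd : fderiv ℝ (fun X => χ R X * G X) (x, t) v =
            χ R (x, t) * fderiv ℝ G (x, t) v + G (x, t) * fderiv ℝ (χ R) (x, t) v := by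
          rw [fderiv_fun_mul (hχd1.differentiable one_ne_zero _) (hG1.differentiable one_ne_zero _)]
          simp
        rw [hfd]
        refine (enorm_add_sq_le_mul_add_mul hδ _ _).trans (add_le_add ?_ ?_)
        · gcongr
          rw [← ofReal_norm, ← ofReal_norm, norm_mul]
          refine ENNReal.ofReal_le_ofReal (mul_le_of_le_one_left (norm_nonneg _) (hχ1 _))
        · rw [enorm_mul, mul_pow]
          have hg : ‖fderiv ℝ (χ R) (x, t) v‖ₑ ^ 2 ≤
              ENNReal.ofReal (D ^ 2) * (ENNReal.ofReal (R⁻¹ ^ 2) * J (R⁻¹ * t)) := by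
            by_cases ht : R⁻¹ * t ∈ Icc (-2 : ℝ) 2
            · rw [hJ, indicator_of_mem ht, Pi.one_apply, mul_one,
                ← ENNReal.ofReal_mul (by positivity), ← mul_pow, ← ofReal_norm,
                ← ENNReal.ofReal_pow (norm_nonneg _)]
              gcongr
              exact hχg _ _ hv
            · have hlt : 2 * R < ‖((x, t) : EuclideanSpace ℝ (Fin n) × ℝ)‖ := by
                rw [mem_Icc, ← abs_le, not_le, abs_mul, abs_of_pos (by positivity : 0 < R⁻¹),
                  lt_inv_mul_iff₀ hR] at ht
                calc 2 * R = R * 2 := mul_comm _ _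
                  _ < |t| := ht
                  _ ≤ _ := norm_snd_le (x, t)
              rw [hχz _ hlt]
              simp
          calc _ ≤ ENNReal.ofReal (1 + δ⁻¹) * (‖G (x, t)‖ₑ ^ 2 *
                (ENNReal.ofReal (D ^ 2) * (ENNReal.ofReal (R⁻¹ ^ 2) * J (R⁻¹ * t)))) := by gcongr
            _ = _ := by ring
      refine (lintegral_mono hpt).trans ?_
      rw [lintegral_add_left ((hcd.measurable.enorm.pow_const 2).const_mul _),
        lintegral_const_mul _ (hcd.measurable.enorm.pow_const 2),
        lintegral_const_mul _ (hcG.measurable.enorm.pow_const 2)]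
      refine add_le_add le_rfl ?_
      calc _ ≤ (ENNReal.ofReal (1 + δ⁻¹) * ENNReal.ofReal (D ^ 2) *
            (ENNReal.ofReal (R⁻¹ ^ 2) * J (R⁻¹ * t))) * B := by gcongr; exact hGB t
        _ = _ := by rw [hP]; ring
    rw [weightedEnergy_eq σ (hχd1.mul hG1), weightedEnergy_eq σ hG1]
    have hstep : ∀ t, ENNReal.ofReal (|t| ^ (1 - 2 * σ)) *
        ((∑ i, ∫⁻ x, ‖fderiv ℝ (fun X => χ R X * G X) (x, t) (EuclideanSpace.single i 1, 0)‖ₑ ^ 2)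
        + ∫⁻ x, ‖fderiv ℝ (fun X => χ R X * G X) (x, t) (0, 1)‖ₑ ^ 2) ≤
        ENNReal.ofReal (1 + δ) * (ENNReal.ofReal (|t| ^ (1 - 2 * σ)) *
          ((∑ i, ∫⁻ x, ‖fderiv ℝ G (x, t) (EuclideanSpace.single i 1, 0)‖ₑ ^ 2)
          + ∫⁻ x, ‖fderiv ℝ G (x, t) (0, 1)‖ₑ ^ 2)) +
        ((n + 1) * P * ENNReal.ofReal (R⁻¹ ^ 2)) *
          (ENNReal.ofReal (|t| ^ (1 - 2 * σ)) * J (R⁻¹ * t)) := by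
      intro t
      have h1 := Finset.sum_le_sum fun (i : Fin n) (_ : i ∈ Finset.univ) =>
        hdir (EuclideanSpace.single i 1, 0) (norm_single_zero_le i) t
      have h2 := hdir (0, 1) (by simp [Prod.norm_def]) t
      refine (mul_le_mul_right (add_le_add h1 h2) _).trans_eq ?_
      rw [Finset.sum_add_distrib, ← Finset.mul_sum, Finset.sum_const, Finset.card_univ,
        Fintype.card_fin, nsmul_eq_mul]
      ring
    refine (lintegral_mono hstep).trans ?_
    have hm : Measurable fun t : ℝ => ENNReal.ofReal (|t| ^ (1 - 2 * σ)) * J (R⁻¹ * t) :=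
      Measurable.mul (by fun_prop) (hJm.comp (by fun_prop))
    rw [lintegral_add_right _ (hm.const_mul _), lintegral_const_mul' _ _ ENNReal.ofReal_ne_top,
      lintegral_const_mul _ hm, lintegral_abs_rpow_comp_mul _ J (by positivity : 0 < R⁻¹), ← hI]
    refine add_le_add le_rfl ?_
    have hR2 : ENNReal.ofReal (R⁻¹ ^ 2) * ENNReal.ofReal (R⁻¹ ^ (-1 - (1 - 2 * σ))) =
        ENNReal.ofReal (R ^ (-(2 * σ))) := by
      rw [← ENNReal.ofReal_mul (by positivity), ← Real.rpow_natCast,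
        ← Real.rpow_add (by positivity), Real.inv_rpow hR.le, ← Real.rpow_neg hR.le]
      congr 2; push_cast; ring
    rw [← hR2, hK]
    apply le_of_eq
    ring
  obtain ⟨r, hr⟩ := hΛ.subset_closedBall 0
  have hlim : Tendsto (fun R : ℝ => K * ENNReal.ofReal (R ^ (-(2 * σ)))) atTop (𝓝 0) := by
    have h1 := ENNReal.tendsto_ofReal (tendsto_rpow_neg_atTop (by positivity : 0 < 2 * σ))
    have h2 := ENNReal.Tendsto.const_mul h1 (Or.inr hKt)
    simpa using h2
  have hev := (hlim.eventually_lt_const (ENNReal.ofReal_pos.2 hδ)).and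
    ((eventually_ge_atTop r).and (eventually_gt_atTop 0))
  obtain ⟨R, hRK, hRr, hR⟩ := hev.exists
  obtain ⟨hχd, hχs, hχ1, hχe, hχg, hχz⟩ := hχ R hR
  refine ⟨fun X => χ R X * G X, hχd.mul hG, hχs.mul_right, fun x hx => ?_,
    (hscale R hR).trans (by gcongr)⟩
  have := hr hx
  rw [mem_closedBall_zero_iff] at this
  dsimp only
  rw [hχe _ (by simpa [Prod.norm_def, hR.le] using this.trans hRr), one_mul]

end FracCapacity

/-! ### Comparison of the two capacities. -/

namespace FracCapacity

open MeasureTheory Set Filter Topology FourierTransform SchwartzMap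

/-- Since `0 < 2σ < 2`, `k^(2σ) ≤ 1 + k²`, and both terms are integrable against `|F|²`. -/
theorem lintegral_rpow_mul_enorm_sq_lt_top {E : Type*} [NormedAddCommGroup E]
    [InnerProductSpace ℝ E] [FiniteDimensional ℝ E] [MeasurableSpace E] [BorelSpace E]
    (F : 𝓢(E, ℂ)) {σ : ℝ} (hσ0 : 0 < σ) (hσ1 : σ < 1) :
    ∫⁻ ξ, ENNReal.ofReal ((2 * Real.pi * ‖ξ‖) ^ (2 * σ)) * ‖F ξ‖ₑ ^ 2 < ⊤ := by
  have hF : Measurable fun ξ => ‖F ξ‖ₑ ^ 2 := F.continuous.measurable.enorm.pow_const 2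
  have h : ∀ w : E → ℂ, MemLp w 2 → ∫⁻ ξ, ‖w ξ‖ₑ ^ 2 < ⊤ := fun w hw => by
    have := lintegral_rpow_enorm_lt_top_of_eLpNorm_lt_top two_ne_zero ENNReal.ofNat_ne_top hw.2
    simpa using this
  have h0 := h F (F.memLp 2)
  have h1 := h (fun ξ => ((2 * Real.pi * ‖ξ‖ : ℝ) : ℂ) * F ξ)
    (memLp_two_of_norm_le_pow_mul F (C := 2 * Real.pi) (j := 1) (by fun_prop) fun ξ => by
      rw [norm_mul, Complex.norm_real, Real.norm_of_nonneg (by positivity), pow_one, mul_assoc])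
  refine lt_of_le_of_lt (lintegral_mono fun ξ => ?_)
    (lt_of_eq_of_lt (lintegral_add_left hF _) (ENNReal.add_lt_top.2 ⟨h0, h1⟩))
  have hk : 0 ≤ 2 * Real.pi * ‖ξ‖ := by positivity
  rw [enorm_mul, mul_pow, ← ofReal_norm ((2 * Real.pi * ‖ξ‖ : ℝ) : ℂ), Complex.norm_real,
    Real.norm_of_nonneg hk, ← ENNReal.ofReal_pow hk]
  generalize 2 * Real.pi * ‖ξ‖ = k at hk
  rcases le_total k 1 with h1 | h1
  · refine le_add_right (mul_le_of_le_one_left zero_le ?_)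
    rw [ENNReal.ofReal_le_one]
    exact Real.rpow_le_one hk h1 (by positivity)
  · refine le_add_left ?_
    gcongr
    rw [← Real.rpow_natCast]
    exact Real.rpow_le_rpow_of_exponent_le h1 (by push_cast; linarith)

/-- The complexification of a test function as a Schwartz function. -/
theorem exists_schwartz_eq {E : Type*} [NormedAddCommGroup E] [NormedSpace ℝ E] {f : E → ℝ}
    (hf : ContDiff ℝ ∞ f) (hfs : HasCompactSupport f) : ∃ S : 𝓢(E, ℂ), ∀ x, S x = (f x : ℂ) :=
  ⟨HasCompactSupport.toSchwartzMap (f := fun x => (f x : ℂ))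
    (hfs.comp_left (g := fun r : ℝ => (r : ℂ)) (by simp))
    (Complex.ofRealCLM.contDiff.comp hf), fun _ => rfl⟩

/-- `F` is the inverse transform of `f`, so that `extension`, built with the forward transform,
restores `f` at `t = 0`. It differs from the transform of `f` by `ξ ↦ -ξ`, which the radial weight
ignores. -/
theorem exists_fourier_preimage {n : ℕ} (σ : ℝ) {f : EuclideanSpace ℝ (Fin n) → ℝ}
    (hf : ContDiff ℝ ∞ f) (hfs : HasCompactSupport f) :
    ∃ F : 𝓢(EuclideanSpace ℝ (Fin n), ℂ), (∀ x, 𝓕 (F : EuclideanSpace ℝ (Fin n) → ℂ) x = f x) ∧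
      fourierEnergy σ f =
        ∫⁻ ξ, ENNReal.ofReal ((2 * Real.pi * ‖ξ‖) ^ (2 * σ)) * ‖F ξ‖ₑ ^ 2 := by
  obtain ⟨S, hS⟩ := exists_schwartz_eq hf hfs
  have hSf : (S : EuclideanSpace ℝ (Fin n) → ℂ) = fun x => (f x : ℂ) := funext hS
  refine ⟨𝓕⁻ S, fun x => ?_, ?_⟩
  · rw [← SchwartzMap.fourier_coe, fourier_fourierInv_eq, hS]
  · rw [fourierEnergy_eq, ← hSf, ← lintegral_neg_eq_self]
    refine lintegral_congr fun ξ => ?_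
    rw [norm_neg, SchwartzMap.fourierInv_coe, Real.fourierInv_eq_fourier_neg]

theorem fourierEnergy_lt_top {n : ℕ} {σ : ℝ} (hσ0 : 0 < σ) (hσ1 : σ < 1)
    {f : EuclideanSpace ℝ (Fin n) → ℝ} (hf : ContDiff ℝ ∞ f) (hfs : HasCompactSupport f) :
    fourierEnergy σ f < ⊤ := by
  obtain ⟨F, -, hF⟩ := exists_fourier_preimage σ hf hfs
  rw [hF]
  exact lintegral_rpow_mul_enorm_sq_lt_top F hσ0 hσ1

/-- Test functions have compactly supported extensions of almost minimal weighted energy. -/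
theorem exists_extension_weightedEnergy_le {n : ℕ} {σ : ℝ} (hσ0 : 0 < σ) (hσ1 : σ < 1)
    {f : EuclideanSpace ℝ (Fin n) → ℝ} (hf : ContDiff ℝ ∞ f) (hfs : HasCompactSupport f)
    {Λ : Set (EuclideanSpace ℝ (Fin n))} (hΛ : Bornology.IsBounded Λ) {δ : ℝ} (hδ : 0 < δ) :
    ∃ H : EuclideanSpace ℝ (Fin n) × ℝ → ℝ, ContDiff ℝ ∞ H ∧ HasCompactSupport H ∧
      (∀ x ∈ Λ, H (x, 0) = f x) ∧
      weightedEnergy σ H ≤ ENNReal.ofReal ((1 + δ) ^ 2) *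
        (ENNReal.ofReal (2 * extConst σ) * fourierEnergy σ f) + ENNReal.ofReal δ := by
  obtain ⟨F, hFf, hF⟩ := exists_fourier_preimage σ hf hfs
  obtain ⟨ν, φ, φ', C, hν, hmom, hchar, hφ0, hφ, hφ'c, hC, hC', hM⟩ := exists_profile hσ0 hσ1 hδ
  have hφc : Continuous φ := continuous_iff_continuousAt.2 fun t => (hφ t).continuousAt
  have hU := contDiff_extension F hmom hchar
  have hB : ENNReal.ofReal (C ^ 2) * ∫⁻ ξ, ‖F ξ‖ₑ ^ 2 ≠ ⊤ := by
    refine ENNReal.mul_ne_top ENNReal.ofReal_ne_top ?_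
    have := lintegral_rpow_enorm_lt_top_of_eLpNorm_lt_top two_ne_zero ENNReal.ofNat_ne_top
      (F.memLp 2 volume).2
    simpa using this.ne
  obtain ⟨H, hH, hHs, hHf, hHE⟩ := exists_compactSupport_weightedEnergy_le hσ0 hσ1
    (G := fun X => (extension F φ X).re) (Complex.reCLM.contDiff.comp hU) hB
    (fun t => (lintegral_mono fun x => by gcongr; exact enorm_re_le _).trans
      (lintegral_extension_sq_le hφc hC t)) hΛ hδ
  refine ⟨H, hH, hHs, fun x hx => ?_, hHE.trans ?_⟩
  · rw [hHf x hx, extension]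
    have : symbolMul F φ 0 = F := by
      funext ξ; simp [symbolMul, hφ0]
    dsimp only
    rw [this, hFf, Complex.ofReal_re]
  · have h := weightedEnergy_re_extension_le hU hφ hφ'c hC hC' hM
    rw [← hF] at h
    -- One factor `1 + δ` comes from the almost minimal profile, the other from the cutoff.
    refine add_le_add ((mul_le_mul_right h _).trans_eq ?_) le_rfl
    rw [ENNReal.ofReal_mul (by positivity), ENNReal.ofReal_pow (by positivity)]
    ring

theorem fracCap_le {n : ℕ} (σ : ℝ) {Λ : Set (EuclideanSpace ℝ (Fin n))}
    {f : EuclideanSpace ℝ (Fin n) → ℝ} (hf : ContDiff ℝ ∞ f) (hfs : HasCompactSupport f)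
    (hfΛ : ∀ x ∈ Λ, 1 ≤ f x) : fracCap σ Λ ≤ fourierEnergy σ f :=
  sInf_le ⟨f, ⟨hf, hfs, hfΛ⟩, rfl⟩

theorem extCap_le {n : ℕ} (σ : ℝ) {Λ : Set (EuclideanSpace ℝ (Fin n))}
    {G : EuclideanSpace ℝ (Fin n) × ℝ → ℝ} (hG : ContDiff ℝ ∞ G) (hGs : HasCompactSupport G)
    (hGΛ : ∀ x ∈ Λ, 1 ≤ G (x, 0)) : extCap σ Λ ≤ weightedEnergy σ G :=
  sInf_le ⟨G, ⟨hG, hGs, hGΛ⟩, rfl⟩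

/-- Let `δ → 0` in `exists_extension_weightedEnergy_le`; finiteness of the Fourier energy makes the
product with `(1 + δ)²` converge. -/
theorem extCap_le_mul_fourierEnergy {n : ℕ} {σ : ℝ} (hσ0 : 0 < σ) (hσ1 : σ < 1)
    {f : EuclideanSpace ℝ (Fin n) → ℝ} (hf : ContDiff ℝ ∞ f) (hfs : HasCompactSupport f)
    {Λ : Set (EuclideanSpace ℝ (Fin n))} (hΛ : Bornology.IsBounded Λ) (hfΛ : ∀ x ∈ Λ, 1 ≤ f x) :
    extCap σ Λ ≤ ENNReal.ofReal (2 * extConst σ) * fourierEnergy σ f := by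
  set Y := ENNReal.ofReal (2 * extConst σ) * fourierEnergy σ f with hY
  have hYt : Y ≠ ⊤ :=
    ENNReal.mul_ne_top ENNReal.ofReal_ne_top (fourierEnergy_lt_top hσ0 hσ1 hf hfs).ne
  have hle : ∀ δ : ℝ, 0 < δ → extCap σ Λ ≤ ENNReal.ofReal ((1 + δ) ^ 2) * Y + ENNReal.ofReal δ := by
    intro δ hδ
    obtain ⟨H, hH, hHs, hHf, hHE⟩ := exists_extension_weightedEnergy_le hσ0 hσ1 hf hfs hΛ hδ
    exact (extCap_le σ hH hHs fun x hx => (hfΛ x hx).trans_eq (hHf x hx).symm).trans hHE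
  have hlim : Tendsto (fun δ : ℝ => ENNReal.ofReal ((1 + δ) ^ 2) * Y + ENNReal.ofReal δ)
      (𝓝[>] 0) (𝓝 Y) := by
    have h1 : Tendsto (fun δ : ℝ => ENNReal.ofReal ((1 + δ) ^ 2)) (𝓝[>] 0) (𝓝 1) := by
      have : Continuous fun δ : ℝ => ENNReal.ofReal ((1 + δ) ^ 2) :=
        ENNReal.continuous_ofReal.comp (by fun_prop)
      simpa using (this.tendsto 0).mono_left nhdsWithin_le_nhds
    have h2 : Tendsto (fun δ : ℝ => ENNReal.ofReal δ) (𝓝[>] 0) (𝓝 0) := by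
      simpa using (ENNReal.continuous_ofReal.tendsto 0).mono_left nhdsWithin_le_nhds
    simpa using (ENNReal.Tendsto.mul_const h1 (Or.inr hYt)).add h2
  exact ge_of_tendsto hlim (eventually_mem_nhdsWithin.mono fun δ hδ => hle δ hδ)

theorem fracCap_ne_top {n : ℕ} {σ : ℝ} (hσ0 : 0 < σ) (hσ1 : σ < 1)
    {Λ : Set (EuclideanSpace ℝ (Fin n))} (hΛ : Bornology.IsBounded Λ) : fracCap σ Λ ≠ ⊤ := by
  obtain ⟨r, hr0, hr⟩ := hΛ.subset_closedBall_lt 0 0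
  let b : ContDiffBump (0 : EuclideanSpace ℝ (Fin n)) := ⟨r, r + 1, hr0, by linarith⟩
  refine ne_top_of_le_ne_top (fourierEnergy_lt_top hσ0 hσ1 b.contDiff b.hasCompactSupport).ne
    (fracCap_le σ b.contDiff b.hasCompactSupport fun x hx => ?_)
  exact (b.one_of_mem_closedBall (hr hx)).ge

theorem extCap_eq_mul_fracCap {n : ℕ} {σ : ℝ} (hσ0 : 0 < σ) (hσ1 : σ < 1)
    {Λ : Set (EuclideanSpace ℝ (Fin n))} (hΛ : Bornology.IsBounded Λ) :
    extCap σ Λ = ENNReal.ofReal (2 * extConst σ) * fracCap σ Λ := by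
  have hN : ENNReal.ofReal (2 * extConst σ) ≠ 0 := by
    have h1 := Real.Gamma_pos_of_pos hσ0
    have h2 := Real.Gamma_pos_of_pos (sub_pos.2 hσ1)
    rw [ENNReal.ofReal_ne_zero_iff, extConst]
    positivity
  refine le_antisymm ?_ (le_sInf ?_)
  -- The constant is neither `0` nor `⊤`, so it passes inside the infimum over test functions.
  · rw [fracCap, sInf_image, ENNReal.mul_iInf_of_ne ?_ ENNReal.ofReal_ne_top]
    · refine le_iInf fun f => ?_
      rw [ENNReal.mul_iInf_of_ne ?_ ENNReal.ofReal_ne_top]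
      · exact le_iInf fun hf => extCap_le_mul_fourierEnergy hσ0 hσ1 hf.1 hf.2.1 hΛ hf.2.2
      · exact hN
    · exact hN
  -- Conversely, the trace `G(·, 0)` is itself a competitor for `fracCap`.
  · rintro _ ⟨G, ⟨hG, hGs, hGΛ⟩, rfl⟩
    refine le_trans (mul_le_mul_right (fracCap_le σ (f := fun x => G (x, 0)) ?_ ?_ hGΛ) _)
      (mul_fourierEnergy_le_weightedEnergy hσ0 hσ1 hG hGs)
    · exact hG.comp (by fun_prop)
    · exact HasCompactSupport.of_support_subset_isCompact (hGs.isCompact.image continuous_fst)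
        fun x hx => ⟨(x, 0), subset_tsupport G hx, rfl⟩

end FracCapacity

/-- Finiteness of `extCap` is implied: by the identity it is a finite constant times a finite
capacity. -/
theorem proposition2p1 (n : ℕ) (hn : 1 ≤ n) (σ : ℝ) (hσ0 : 0 < σ) (hσ1 : σ < 1)
    (Λ : Set (EuclideanSpace ℝ (Fin n))) (hΛ : IsCompact Λ) :
    FracCapacity.fracCap σ Λ ≠ ⊤ ∧
      FracCapacity.extCap σ Λ =
        ENNReal.ofReal (2 * FracCapacity.extConst σ) * FracCapacity.fracCap σ Λ :=
  ⟨FracCapacity.fracCap_ne_top hσ0 hσ1 hΛ.isBounded,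
    FracCapacity.extCap_eq_mul_fracCap hσ0 hσ1 hΛ.isBounded⟩
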